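/- All graphs are finite and simple. A graph is \emph{prolific} if it is connected and is not isomorphic to a path $P_k$ ($k\ge 1$), a cycle $C_k$ ($k\ge 3$) or the star $K_{1,3}$; let $\mathcal F$ be the family of all prolific graphs. The line graph $L(G)$ has vertex set $E(G)$, two edges of $G$ being adjacent in $L(G)$ if they are distinct and share an endpoint; put $L^0(G)=G$ and $L^{k}(G)=L(L^{k-1}(G))$ for $k\ge 1$. Let $\mu(G)$ be the matching number of $G$ (the largest number of edges in a matching), let $\mathrm{ind}(\mu,G)=\min\{r : \mu(G)<\mu(L^r(G))\}$, and let $k(\mu,\mathcal F)=\max\{\mathrm{ind}(\mu,G) : G\in\mathcal F\}$ (in both cases $\infty$ if there is no such number). A subdivision of $K_{1,3}$ consists of three paths with $m_1,m_2,m_3\ge 1$ edges that share one end vertex, the centre, and are otherwise disjoint; it is of \emph{type A} (respectively \emph{type B}) if exactly two (respectively exactly one) of the neighbours of the centre are leaves. For type B the paths are labelled so that $m_1\ge m_2>m_3=1$. \textbf{Theorem.} Let $G$ be a prolific graph on $n$ vertices. Then $\mathrm{ind}(\mu,G)\le 4$. Moreover, $\mathrm{ind}(\mu,G)=4$ if and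 only if either $n$ is odd and $G$ is a type A subdivision of $K_{1,3}$, or $n$ is even and $G$ is a type B subdivision of $K_{1,3}$ with $m_1$ and $m_2$ even. Hence $k(\mu,\mathcal F)=4$. -/

import Mathlib

universe u

/-- A graph together with its vertex type. -/
abbrev AnyGraph : Type (u + 1) := Σ V : Type u, SimpleGraph V

/-- The line graph. -/
def AnyGraph.line (X : AnyGraph.{u}) : AnyGraph.{u} := ⟨X.2.edgeSet, X.2.lineGraph⟩

/-- The iterated line graph: `L^0(G) = G` and `L^(k+1)(G) = L(L^k(G))`. -/
def AnyGraph.iterLine : ℕ → AnyGraph.{u} → AnyGraph.{u}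
  | 0, X => X
  | k + 1, X => (AnyGraph.iterLine k X).line

/-- A prolific graph: a finite connected simple graph that is not isomorphic to a path, a cycle or
the star `K_{1,3}`. -/
def IsProlific (X : AnyGraph.{u}) : Prop :=
  Finite X.1 ∧ X.2.Connected ∧
    (∀ k : ℕ, ¬ Nonempty (X.2 ≃g SimpleGraph.pathGraph k)) ∧
    (∀ k : ℕ, 3 ≤ k → ¬ Nonempty (X.2 ≃g SimpleGraph.cycleGraph k)) ∧
    ¬ Nonempty (X.2 ≃g completeBipartiteGraph (Fin 1) (Fin 3))

/-- The matching number: the largest number of edges of a matching. -/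
noncomputable def matchingNumber (X : AnyGraph.{u}) : ℕ∞ :=
  ⨆ M : {M : X.2.Subgraph // M.IsMatching}, M.1.edgeSet.encard

/-- `ind(P, G) = min {r : P(G) < P(L^r(G))}`, with value `⊤` if there is no such `r`. -/
noncomputable def paramIndex (P : AnyGraph.{u} → ℕ∞) (X : AnyGraph.{u}) : ℕ∞ :=
  ⨅ (r : ℕ) (_ : P X < P (AnyGraph.iterLine r X)), (r : ℕ∞)

/-- `k(P, F) = max {ind(P, G) : G ∈ F}`, with value `⊤` if the indices are not bounded. For a
nonempty family a finite supremum in `ℕ∞` is attained, so it is a maximum. -/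
noncomputable def familyIndex (P : AnyGraph.{u} → ℕ∞) (F : Set AnyGraph.{u}) : ℕ∞ :=
  ⨆ X ∈ F, paramIndex P X

/-- The subdivision of `K_{1,3}` in which the three edges are replaced by paths with `m 0`, `m 1`,
`m 2` edges. The centre is `none`, and `some ⟨i, j⟩` is the vertex of the `i`-th path at distance
`j + 1` from the centre. -/
def subdividedClaw (m : Fin 3 → ℕ) : SimpleGraph (Option (Σ i : Fin 3, Fin (m i))) :=
  SimpleGraph.fromRel fun x y =>
    match x, y with
    | none, some ⟨_, j⟩ => j.val = 0
    | some ⟨i, j⟩, some ⟨i', j'⟩ => i = i' ∧ j'.val = j.val + 1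
    | _, none => False

/-- The number of leaves (vertices of degree 1) adjacent to the centre. -/
noncomputable def centreLeaves (m : Fin 3 → ℕ) : ℕ :=
  {w | (subdividedClaw m).Adj none w ∧ ((subdividedClaw m).neighborSet w).ncard = 1}.ncard

/-- `G` is a subdivision of `K_{1,3}` whose three paths at the centre have `m 0`, `m 1`, `m 2`
edges. -/
def IsClawSubdivision (X : AnyGraph.{u}) (m : Fin 3 → ℕ) : Prop :=
  (∀ i, 1 ≤ m i) ∧ Nonempty (X.2 ≃g subdividedClaw m)

/-- Type A: the centre is adjacent to exactly two leaves. -/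
def IsTypeA (X : AnyGraph.{u}) (m : Fin 3 → ℕ) : Prop :=
  IsClawSubdivision X m ∧ centreLeaves m = 2

/-- Type B: the centre is adjacent to exactly one leaf. -/
def IsTypeB (X : AnyGraph.{u}) (m : Fin 3 → ℕ) : Prop :=
  IsClawSubdivision X m ∧ centreLeaves m = 1

-- Write `n_r` for the order of `L^r(G)`, so that `n_{r+1}` is the number of edges of `L^r(G)`. Two
-- facts reduce the theorem to arithmetic with these orders.
--
-- First, the line graph of a connected graph has a matching missing at most one vertex
-- (`card_half_le_matchingNumber_lineGraph`). Hence `μ(L^r(G)) = ⌊n_r/2⌋` for `r ≥ 1`, whereas only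
-- `μ(G) ≤ ⌊n_0/2⌋` holds in general.
--
-- Second, `n_{r+2} - 2 n_{r+1} + n_r` is half the sum of `(d-1)(d-2)` over the degrees `d` of
-- `L^r(G)` (`sum_excess`). Thus the orders form a convex sequence, and branch vertices make it
-- strictly convex.
--
-- Let `n = n_0`. Connectedness gives `n_1 ≥ n - 1`, and a prolific graph has a vertex of degree at
-- least 3. A cycle in `G`, a vertex of degree at least 4 or a second branch vertex forces `n_3 ≥ n
-- + 2`, so the index is at most 3 (`IsProlific.claw_or_large`). What remains is a tree with one
-- branch vertex, of degree 3: a subdivided claw.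
--
-- For a claw with `t` arms of length at least 2, `n_1 = n_2 = n - 1`, `n_3 = n - 1 + t` and `n_4 ≥
-- n - 1 + 2t`; type A is `t = 1`, type B is `t = 2`, and `t = 0` is the excluded star. If `t = 3`,
-- the index is at most 3. If `t = 2`, it is at most 4, with equality exactly when `n` is even and
-- `G` has a perfect matching, that is, when both long arms are even. If `t = 1`, two leaves share a
-- neighbour, so there is no perfect matching: for even `n` already `n_3 = n` suffices, while for
-- odd `n` the claw has a near-perfect matching and the index is 4 (`claw_paramIndex`).

universe v

open SimpleGraph

/-! ### Matchings as involutions -/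

/-- An involution that moves every vertex either to itself or to a neighbour: a matching, the
unmatched vertices being the fixed points. -/
def IsMatchingInvolution {V : Type*} (G : SimpleGraph V) (σ : V → V) : Prop :=
  Function.Involutive σ ∧ ∀ v, σ v ≠ v → G.Adj v (σ v)

section matching
variable {V : Type u} {G : SimpleGraph V}

theorem ncard_verts_of_isMatching [Finite V] {M : G.Subgraph} (h : M.IsMatching) :
    M.verts.ncard = 2 * M.edgeSet.ncard := by
  classical
  have := Fintype.ofFinite V
  rw [Subgraph.isMatching_iff_forall_degree] at h
  have h1 := M.coe.sum_degrees_eq_twice_card_edges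
  rw [← Subgraph.image_coe_edgeSet_coe,
    Set.ncard_image_of_injective _ (Sym2.map.injective Subtype.val_injective)]
  rw [← Set.ncard_coe_finset, coe_edgeFinset] at h1
  rw [← h1]
  trans ∑ _x : M.verts, 1
  · simp [← Nat.card_eq_fintype_card, Nat.card_coe_set_eq]
  · refine Finset.sum_congr rfl fun x _ => ?_
    rw [Subgraph.coe_degree]
    convert (h x x.2).symm

/-- The matching of the moved points of a matching involution. -/
def IsMatchingInvolution.toSubgraph {σ : V → V} (h : IsMatchingInvolution G σ) : G.Subgraph where
  verts := {v | σ v ≠ v}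
  Adj v w := σ v = w ∧ v ≠ w
  adj_sub := by
    rintro v w ⟨rfl, hne⟩
    exact h.2 v hne.symm
  edge_vert := by
    rintro v w ⟨rfl, hne⟩
    exact hne.symm
  symm := by
    refine ⟨?_⟩
    rintro v w ⟨rfl, hne⟩
    exact ⟨h.1 v, hne.symm⟩

theorem IsMatchingInvolution.isMatching {σ : V → V} (h : IsMatchingInvolution G σ) :
    h.toSubgraph.IsMatching := by
  intro v hv
  exact ⟨σ v, ⟨rfl, Ne.symm hv⟩, fun w hw => hw.1.symm⟩

/-- The number of moved points is even, so the slack of 1 costs nothing; it lets an involution with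
a single fixed point give half the order, rounded down. -/
theorem le_matchingNumber [Finite V] {σ : V → V} (h : IsMatchingInvolution G σ) {k : ℕ}
    (hk : 2 * k ≤ {v | σ v ≠ v}.ncard + 1) : (k : ℕ∞) ≤ matchingNumber ⟨V, G⟩ := by
  have h1 := ncard_verts_of_isMatching h.isMatching
  have h2 : k ≤ h.toSubgraph.edgeSet.ncard := by
    change {v | σ v ≠ v}.ncard = _ at h1
    omega
  refine le_trans ?_ (le_iSup (fun M : {M : G.Subgraph // M.IsMatching} => M.1.edgeSet.encard)
    ⟨_, h.isMatching⟩)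
  rw [← Set.Finite.cast_ncard_eq (Set.toFinite _)]
  exact_mod_cast h2

theorem exists_involution_of_isMatching {M : G.Subgraph} (h : M.IsMatching) :
    ∃ σ, IsMatchingInvolution G σ ∧ {v | σ v ≠ v} = M.verts := by
  classical
  choose! f hf hf' using fun v => h (v := v)
  have hmem : ∀ v ∈ M.verts, f v ∈ M.verts := fun v hv => M.edge_vert (hf v hv).symm
  refine ⟨fun v => if v ∈ M.verts then f v else v, ⟨fun v => ?_, fun v hv => ?_⟩, ?_⟩
  · by_cases hv : v ∈ M.verts
    · simp only [hv, if_true, hmem v hv]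
      exact (hf' _ (hmem v hv) v (hf v hv).symm).symm
    · simp [hv]
  · by_cases hm : v ∈ M.verts
    · simpa [hm] using (hf v hm).adj_sub
    · simp [hm] at hv
  · ext v
    by_cases hm : v ∈ M.verts
    · simpa [hm] using (hf v hm).adj_sub.ne'
    · simp [hm]

theorem matchingNumber_le [Finite V] {k : ℕ}
    (hk : ∀ σ, IsMatchingInvolution G σ → {v | σ v ≠ v}.ncard ≤ 2 * k + 1) :
    matchingNumber ⟨V, G⟩ ≤ k := by
  refine iSup_le fun ⟨M, hM⟩ => ?_
  obtain ⟨σ, hσ, h1⟩ := exists_involution_of_isMatching hM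
  have h2 := ncard_verts_of_isMatching hM
  have h3 := hk σ hσ
  rw [h1] at h3
  change M.edgeSet.encard ≤ k
  rw [← Set.Finite.cast_ncard_eq (Set.toFinite _)]
  have : M.edgeSet.ncard ≤ k := by omega
  exact_mod_cast this

theorem matchingNumber_le_card_half [Finite V] :
    matchingNumber ⟨V, G⟩ ≤ (Nat.card V / 2 : ℕ) := by
  refine matchingNumber_le fun σ _ => ?_
  have := Set.ncard_le_card {v | σ v ≠ v}
  omega

/-- If the matching number is not smaller than half the order, there is a perfect matching. -/
theorem exists_perfect_involution [Finite V] {k : ℕ} (hk : Nat.card V = 2 * k)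
    (h : (k : ℕ∞) ≤ matchingNumber ⟨V, G⟩) :
    ∃ σ, IsMatchingInvolution G σ ∧ ∀ v, σ v ≠ v := by
  by_contra! hcon
  -- The bound `k - 1` used below is a truncated subtraction. For `k = 0` the graph is empty and the
  -- identity is already a perfect matching.
  have hk0 : k ≠ 0 := by
    rintro rfl
    have : IsEmpty V := by
      simpa [Nat.card_eq_zero, not_infinite_iff_finite.2 ‹_›] using hk
    obtain ⟨v, _⟩ := hcon id ⟨fun _ => rfl, fun v => by simp⟩
    exact isEmptyElim v
  have : matchingNumber ⟨V, G⟩ ≤ (k - 1 : ℕ) := by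
    refine matchingNumber_le fun σ hσ => ?_
    obtain ⟨v, hv⟩ := hcon σ hσ
    have := Set.ncard_lt_card (s := {v | σ v ≠ v}) (fun h => by
      have : v ∈ {v | σ v ≠ v} := h ▸ Set.mem_univ v
      exact this hv)
    omega
  have := h.trans this
  have : k ≤ k - 1 := by exact_mod_cast this
  omega

/-- Two universes are needed: subdivided claws live in `Type`, the given graph in `Type u`. -/
theorem matchingNumber_le_of_iso {W : Type v} {H : SimpleGraph W} [Finite V] (e : G ≃g H) :
    matchingNumber ⟨V, G⟩ ≤ matchingNumber ⟨W, H⟩ := by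
  have : Finite W := Finite.of_equiv V e.toEquiv
  refine iSup_le fun ⟨M, hM⟩ => ?_
  obtain ⟨σ, hσ, h1⟩ := exists_involution_of_isMatching hM
  have h2 := ncard_verts_of_isMatching hM
  change M.edgeSet.encard ≤ _
  rw [← Set.Finite.cast_ncard_eq (Set.toFinite _)]
  refine le_matchingNumber (σ := fun w => e (σ (e.symm w))) ⟨fun w => ?_, fun w hw => ?_⟩ ?_
  · simp [hσ.1 _]
  · have : σ (e.symm w) ≠ e.symm w := fun h => hw (by simp [h])
    have := e.map_adj_iff.2 (hσ.2 _ this)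
    simpa using this
  · rw [← h2, ← h1, ← Set.ncard_image_of_injective _ e.injective]
    refine Nat.le_succ_of_le (Set.ncard_le_ncard ?_)
    rintro _ ⟨v, hv, rfl⟩
    simpa using hv

end matching

theorem matchingNumber_congr {V : Type u} {W : Type v} {G : SimpleGraph V} {H : SimpleGraph W}
    [Finite V] (e : G ≃g H) : matchingNumber ⟨V, G⟩ = matchingNumber ⟨W, H⟩ := by
  have : Finite W := Finite.of_equiv V e.toEquiv
  exact (matchingNumber_le_of_iso e).antisymm (matchingNumber_le_of_iso e.symm)

/-! ### Iterated line graphs -/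

theorem finite_iterLine (X : AnyGraph.{u}) [Finite X.1] (r : ℕ) :
    Finite (AnyGraph.iterLine r X).1 := by
  induction r with
  | zero => assumption
  | succ r ih => exact Subtype.finite

theorem nonempty_iso_iterLine {X : AnyGraph.{u}} {Y : AnyGraph.{v}} (e : X.2 ≃g Y.2) (r : ℕ) :
    Nonempty ((AnyGraph.iterLine r X).2 ≃g (AnyGraph.iterLine r Y).2) := by
  induction r with
  | zero => exact ⟨e⟩
  | succ r ih =>
    obtain ⟨f⟩ := ih
    exact ⟨f.lineGraph⟩

theorem paramIndex_matchingNumber_congr {X : AnyGraph.{u}} {Y : AnyGraph.{v}} [Finite X.1]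
    (e : X.2 ≃g Y.2) : paramIndex matchingNumber X = paramIndex matchingNumber Y := by
  have h : ∀ r, matchingNumber (AnyGraph.iterLine r X) = matchingNumber (AnyGraph.iterLine r Y) := by
    intro r
    have := finite_iterLine X r
    exact matchingNumber_congr (nonempty_iso_iterLine e r).some
  have h0 : matchingNumber X = matchingNumber Y := h 0
  simp only [paramIndex, h, h0]

theorem paramIndex_le {P : AnyGraph.{u} → ℕ∞} {X : AnyGraph.{u}} {r : ℕ}
    (h : P X < P (AnyGraph.iterLine r X)) : paramIndex P X ≤ r :=
  iInf₂_le r h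

theorem le_paramIndex {P : AnyGraph.{u} → ℕ∞} {X : AnyGraph.{u}} {k : ℕ}
    (h : ∀ r < k, P (AnyGraph.iterLine r X) ≤ P X) : (k : ℕ∞) ≤ paramIndex P X := by
  refine le_iInf₂ fun r hr => ?_
  by_contra! hlt
  exact (h r (by exact_mod_cast hlt)).not_gt hr

/-! ### Connected graphs: near-perfect matchings of the line graph -/

section lineMatching
variable {V : Type u} {H : SimpleGraph V}

theorem lineGraph_preconnected (h : H.Preconnected) : H.lineGraph.Preconnected := by
  have adj_reach : ∀ (e f : H.edgeSet) (a : V), a ∈ e.1 → a ∈ f.1 → H.lineGraph.Reachable e f := by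
    intro e f a he hf
    by_cases hef : e = f
    · rw [hef]
    · exact Adj.reachable ⟨hef, a, he, hf⟩
  have key : ∀ a b : V, H.Reachable a b → ∀ e f : H.edgeSet, a ∈ e.1 → b ∈ f.1 →
      H.lineGraph.Reachable e f := by
    rintro a b ⟨p⟩
    induction p with
    | nil => exact fun e f he hf => adj_reach e f _ he hf
    | @cons a c b hac p ih =>
      intro e f he hf
      exact (adj_reach e ⟨s(a, c), hac⟩ a he (by simp)).trans
        (ih ⟨s(a, c), hac⟩ f (by simp) hf)
  rintro ⟨e, he⟩ ⟨f, hf⟩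
  induction e with
  | h a a' => induction f with
    | h b b' => exact key a b (h a b) _ _ (by simp) (by simp)

open Classical in
/-- The parities of the fibres of an assignment of an end vertex to each edge. -/
noncomputable def fibreParity [Fintype H.edgeSet] (f : H.edgeSet → V) : V → ZMod 2 :=
  ∑ e, Pi.single (f e) 1

-- Reassigning the edge `ab` to its other end changes the parity of both fibres. Modulo 2 it does
-- not matter which end it had before.
open Classical in
theorem exists_flip_of_adj [Fintype H.edgeSet] {a b : V} (hab : H.Adj a b) (f : H.edgeSet → V)
    (hf : ∀ e, f e ∈ e.1) : ∃ f' : H.edgeSet → V, (∀ e, f' e ∈ e.1) ∧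
      fibreParity f' = fibreParity f + Pi.single a 1 + Pi.single b 1 := by
  set e₀ : H.edgeSet := ⟨s(a, b), hab⟩
  have h2 : ∀ x : V → ZMod 2, x + x = 0 := fun x =>
    funext fun v => CharTwo.add_self_eq_zero (x v)
  have key : ∀ c d : V, s(a, b) = s(c, d) → f e₀ = c → ∃ f' : H.edgeSet → V, (∀ e, f' e ∈ e.1) ∧
      fibreParity f' = fibreParity f + Pi.single c 1 + Pi.single d 1 := by
    intro c d hcd hfc
    refine ⟨Function.update f e₀ d, fun e => ?_, ?_⟩
    · by_cases he : e = e₀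
      · rw [he, Function.update_self]
        change d ∈ s(a, b)
        rw [hcd]
        simp
      · rw [Function.update_of_ne he]
        exact hf e
    · unfold fibreParity
      rw [← Finset.add_sum_erase _ _ (Finset.mem_univ e₀),
        ← Finset.add_sum_erase (a := e₀) _ (fun e => (Pi.single (f e) 1 : V → ZMod 2))
          (Finset.mem_univ e₀), Function.update_self, hfc,
        Finset.sum_congr rfl (g := fun e => (Pi.single (f e) 1 : V → ZMod 2))]
      · have := h2 (Pi.single c 1)
        linear_combination -this
      · intro e he
        rw [Function.update_of_ne (Finset.ne_of_mem_erase he)]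
  have : f e₀ = a ∨ f e₀ = b := by simpa [e₀] using hf e₀
  rcases this with h | h
  · exact key a b rfl h
  · obtain ⟨f', h1, h2⟩ := key b a Sym2.eq_swap h
    exact ⟨f', h1, by rw [h2]; abel⟩

-- Flipping every edge of a walk changes each inner vertex twice, so only the parities at the two
-- ends change.
open Classical in
theorem exists_flip_of_reachable [Fintype H.edgeSet] {a b : V} (hab : H.Reachable a b) :
    ∀ f : H.edgeSet → V, (∀ e, f e ∈ e.1) → ∃ f' : H.edgeSet → V, (∀ e, f' e ∈ e.1) ∧
      fibreParity f' = fibreParity f + Pi.single a 1 + Pi.single b 1 := by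
  have h2 : ∀ x : V → ZMod 2, x + x = 0 := fun x =>
    funext fun v => CharTwo.add_self_eq_zero (x v)
  obtain ⟨p⟩ := hab
  induction p with
  | @nil a =>
    intro f hf
    exact ⟨f, hf, by rw [add_assoc, h2, add_zero]⟩
  | @cons a c b hac p ih =>
    intro f hf
    obtain ⟨f₁, hf₁, e₁⟩ := exists_flip_of_adj hac f hf
    obtain ⟨f₂, hf₂, e₂⟩ := ih f₁ hf₁
    refine ⟨f₂, hf₂, ?_⟩
    rw [e₂, e₁]
    linear_combination h2 (Pi.single c 1)

/-- Take an assignment with the fewest odd fibres. If two vertices had odd fibres, flipping along a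
walk between them would make both even and alter no other parity. -/
theorem exists_assignment_subsingleton_odd [Finite V] [Fintype H.edgeSet] (h : H.Preconnected) :
    ∃ f : H.edgeSet → V, (∀ e, f e ∈ e.1) ∧ {v | fibreParity f v ≠ 0}.Subsingleton := by
  classical
  let S : Set (H.edgeSet → V) := {f | ∀ e, f e ∈ e.1}
  have hS : S.Nonempty := ⟨fun e => e.1.out.1, fun e => Sym2.out_fst_mem _⟩
  obtain ⟨f, hf, hmin⟩ := Set.exists_min_image S (fun f => {v | fibreParity f v ≠ 0}.ncard)
    (Set.toFinite S) hS
  refine ⟨f, hf, fun x hx y hy => ?_⟩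
  by_contra hxy
  obtain ⟨f', hf', e⟩ := exists_flip_of_reachable (h x y) f hf
  refine (hmin f' hf').not_gt (Set.ncard_lt_ncard ?_)
  have one : ∀ z : ZMod 2, z ≠ 0 → z = 1 := by decide
  have two : (1 + 1 : ZMod 2) = 0 := by decide
  refine ⟨fun v hv => ?_, fun hsub => ?_⟩
  · simp only [Set.mem_ofPred_eq, e, Pi.add_apply] at hv ⊢
    by_cases hvx : v = x
    · rwa [hvx]
    by_cases hvy : v = y
    · rwa [hvy]
    simpa [hvx, hvy] using hv
  · have := hsub hx
    simp only [Set.mem_ofPred_eq, e, Pi.add_apply] at this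
    simp [one _ hx, hxy, two] at this

/-- The reversal of `Fin n` fixes only the middle element, which exists only for odd `n`. -/
theorem exists_involution_fixed_subsingleton (A : Type*) [Finite A] :
    ∃ τ : A → A, Function.Involutive τ ∧ {a | τ a = a}.Subsingleton ∧
      ∀ a, τ a = a → Odd (Nat.card A) := by
  obtain ⟨n, ⟨e⟩⟩ := Finite.exists_equiv_fin A
  have hn : Nat.card A = n := by simpa using Nat.card_congr e
  have key : ∀ a, e.symm (e a).rev = a → 2 * (e a).val + 1 = n := by
    intro a ha
    have : (e a).rev = e a := by
      rw [← e.apply_symm_apply (e a).rev, ha]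
    have h1 := congrArg Fin.val this
    rw [Fin.val_rev] at h1
    have := (e a).isLt
    omega
  refine ⟨fun a => e.symm (e a).rev, fun a => by simp, fun a ha b hb => ?_, fun a ha => ?_⟩
  · have h1 := key a ha
    have h2 := key b hb
    exact e.injective (Fin.ext (by omega))
  · rw [hn]
    exact ⟨(e a).val, (key a ha).symm⟩

/-- Edges assigned to the same end vertex are pairwise adjacent in the line graph, so each fibre can
be paired up internally. Only an odd fibre leaves an edge over, and there is at most one such fibre.
-/
theorem card_half_le_matchingNumber_lineGraph [Finite V] (h : H.Preconnected) :
    ((Nat.card H.edgeSet / 2 : ℕ) : ℕ∞) ≤ matchingNumber ⟨H.edgeSet, H.lineGraph⟩ := by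
  classical
  have := Fintype.ofFinite H.edgeSet
  obtain ⟨f, hf, hodd⟩ := exists_assignment_subsingleton_odd h
  choose τ hτ hsub hτo using fun v : V =>
    exists_involution_fixed_subsingleton {e : H.edgeSet // f e = v}
  let σ : H.edgeSet → H.edgeSet := fun e => (τ (f e) ⟨e, rfl⟩).1
  have hσ : ∀ v (x : {e : H.edgeSet // f e = v}), σ x.1 = (τ v x).1 := by
    rintro v ⟨e, rfl⟩
    rfl
  have hfσ : ∀ e, f (σ e) = f e := fun e => (τ (f e) ⟨e, rfl⟩).2
  have hpar : ∀ v, Odd (Nat.card {e : H.edgeSet // f e = v}) → fibreParity f v ≠ 0 := by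
    intro v hv
    have : fibreParity f v = (Nat.card {e : H.edgeSet // f e = v} : ZMod 2) := by
      simp [fibreParity, Finset.sum_apply, Pi.single_apply, Fintype.card_subtype, eq_comm]
    rw [this, (ZMod.natCast_eq_one_iff_odd).2 hv]
    decide
  have hfix : {e | σ e = e}.Subsingleton := by
    intro e he e' he'
    have h1 : τ (f e) ⟨e, rfl⟩ = ⟨e, rfl⟩ := Subtype.ext he
    have h2 : τ (f e') ⟨e', rfl⟩ = ⟨e', rfl⟩ := Subtype.ext he'
    have h3 : f e = f e' := hodd (hpar _ (hτo _ _ h1)) (hpar _ (hτo _ _ h2))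
    have h4 : τ (f e) ⟨e', h3.symm⟩ = ⟨e', h3.symm⟩ :=
      Subtype.ext ((hσ (f e) ⟨e', h3.symm⟩).symm.trans he')
    exact congrArg Subtype.val (hsub (f e) h1 h4)
  refine le_matchingNumber (G := H.lineGraph) (σ := σ) ⟨fun e => ?_, fun e he => ⟨Ne.symm he, f e, hf e, ?_⟩⟩ ?_
  · exact (hσ _ _).trans (congrArg Subtype.val (hτ (f e) ⟨e, rfl⟩))
  · rw [← hfσ e]
    exact hf _
  · have h1 := Set.ncard_add_ncard_compl {e | σ e = e}
    have h2 : {e | σ e = e}.ncard ≤ 1 := Set.ncard_le_one_iff_subsingleton.2 hfix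
    have h3 : {e | σ e = e}ᶜ = {e | σ e ≠ e} := rfl
    rw [h3] at h1
    omega

end lineMatching

/-! ### Counting vertices and edges of line graphs -/

/-- The degree of a vertex, without finiteness instances. -/
noncomputable def ndegree {V : Type*} (G : SimpleGraph V) (v : V) : ℕ := (G.neighborSet v).ncard

section counting
variable {V : Type u} {G : SimpleGraph V}

theorem ndegree_eq_degree (v : V) [Fintype (G.neighborSet v)] : ndegree G v = G.degree v := by
  rw [ndegree, Set.ncard_eq_toFinset_card']
  rfl

theorem ndegree_iso {W : Type*} {H : SimpleGraph W} (e : G ≃g H) (v : V) :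
    ndegree H (e v) = ndegree G v := by
  rw [ndegree, ndegree, ← Set.ncard_image_of_injective _ e.injective]
  congr 1
  ext w
  constructor
  · intro h
    exact ⟨e.symm w, by simpa using e.symm.map_adj_iff.2 h, by simp⟩
  · rintro ⟨x, hx, rfl⟩
    exact e.map_adj_iff.2 hx

theorem ncard_incidenceSet (v : V) : (G.incidenceSet v).ncard = ndegree G v := by
  classical
  exact Nat.card_congr (G.incidenceSetEquivNeighborSet v)

theorem sum_ndegree [Fintype V] : ∑ v, ndegree G v = 2 * Nat.card G.edgeSet := by
  classical
  simp only [ndegree_eq_degree, sum_degrees_eq_twice_card_edges]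
  rw [Nat.card_coe_set_eq, ← coe_edgeFinset, Set.ncard_coe_finset]

/-- The other edges at `a` and the other edges at `b` are disjoint sets, since only `ab` contains
both ends. -/
theorem ndegree_lineGraph [Finite V] {a b : V} (h : G.Adj a b) :
    ndegree G.lineGraph ⟨s(a, b), h⟩ + 2 = ndegree G a + ndegree G b := by
  have key : Subtype.val '' (G.lineGraph.neighborSet ⟨s(a, b), h⟩) =
      (G.incidenceSet a \ {s(a, b)}) ∪ (G.incidenceSet b \ {s(a, b)}) := by
    ext e
    constructor
    · rintro ⟨⟨e, he⟩, ⟨hne, c, hc, hc'⟩, rfl⟩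
      have hne' : e ≠ s(a, b) := fun h' => hne (Subtype.ext h'.symm)
      have : c = a ∨ c = b := by simpa using hc
      rcases this with rfl | rfl
      · exact Or.inl ⟨⟨he, hc'⟩, hne'⟩
      · exact Or.inr ⟨⟨he, hc'⟩, hne'⟩
    · rintro (⟨⟨he, hc⟩, hne⟩ | ⟨⟨he, hc⟩, hne⟩)
      · exact ⟨⟨e, he⟩, ⟨fun h' => hne (congrArg Subtype.val h').symm, a, by simp, hc⟩, rfl⟩
      · exact ⟨⟨e, he⟩, ⟨fun h' => hne (congrArg Subtype.val h').symm, b, by simp, hc⟩, rfl⟩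
  have hdisj : Disjoint (G.incidenceSet a \ {s(a, b)}) (G.incidenceSet b \ {s(a, b)}) := by
    rw [Set.disjoint_left]
    rintro e ⟨⟨_, ha⟩, hne⟩ ⟨⟨_, hb⟩, _⟩
    exact hne (((Sym2.mem_and_mem_iff h.ne).1 ⟨ha, hb⟩))
  have h1 : s(a, b) ∈ G.incidenceSet a := ⟨h, by simp⟩
  have h2 : s(a, b) ∈ G.incidenceSet b := ⟨h, by simp⟩
  have h3 := Set.ncard_sdiff_singleton_add_one h1
  have h4 := Set.ncard_sdiff_singleton_add_one h2
  rw [ncard_incidenceSet] at h3 h4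
  rw [ndegree, ← Set.ncard_image_of_injective _ Subtype.val_injective, key,
    Set.ncard_union_eq hdisj]
  omega

/-- Double counting: each edge contributes the degrees of its ends, so each vertex contributes its
degree once for every incident edge. -/
theorem sum_ndegree_lineGraph [Fintype V] [Fintype G.edgeSet] :
    ∑ e, ndegree G.lineGraph e + 2 * Nat.card G.edgeSet = ∑ v, ndegree G v ^ 2 := by
  classical
  have h1 : ∀ e : G.edgeSet, ndegree G.lineGraph e + 2 =
      ∑ v, if v ∈ e.1 then ndegree G v else 0 := by
    rintro ⟨e, he⟩
    induction e with
    | h a b =>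
      have hab : G.Adj a b := he
      rw [ndegree_lineGraph hab, ← Finset.sum_filter]
      have : Finset.univ.filter (fun v => v ∈ s(a, b)) = {a, b} := by
        ext v
        simp
      rw [this, Finset.sum_pair hab.ne]
  have h2 : ∀ v, ∑ e : G.edgeSet, (if v ∈ e.1 then ndegree G v else 0) = ndegree G v ^ 2 := by
    intro v
    rw [← Finset.sum_filter, Finset.sum_const, smul_eq_mul, sq]
    congr 1
    rw [← ncard_incidenceSet, ← Set.ncard_coe_finset,
      ← Set.ncard_image_of_injective _ Subtype.val_injective]
    congr 1
    ext e
    simp [incidenceSet, and_comm]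
  rw [← Finset.sum_congr rfl fun v _ => h2 v, Finset.sum_comm, ← Finset.sum_congr rfl fun e _ => h1 e,
    Finset.sum_add_distrib]
  simp [mul_comm]

/-- The number of edges of the line graph, through the excess of the degrees over `1` and `2`. -/
theorem sum_excess [Fintype V] :
    ∑ v, ((ndegree G v : ℤ) - 1) * (ndegree G v - 2) =
      2 * (Nat.card G.lineGraph.edgeSet - 2 * Nat.card G.edgeSet + Nat.card V) := by
  classical
  have h1 := sum_ndegree (G := G)
  have h2 := sum_ndegree_lineGraph (G := G)
  rw [sum_ndegree] at h2
  have h3 : ∑ v, ((ndegree G v : ℤ) - 1) * (ndegree G v - 2) =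
      ∑ v, (ndegree G v : ℤ) ^ 2 - 3 * ∑ v, (ndegree G v : ℤ) + 2 * Nat.card V := by
    rw [Finset.mul_sum, ← Finset.sum_sub_distrib, Nat.card_eq_fintype_card]
    have : (2 * (Fintype.card V : ℤ)) = ∑ _v : V, (2 : ℤ) := by simp [mul_comm]
    rw [this, ← Finset.sum_add_distrib]
    exact Finset.sum_congr rfl fun v _ => by ring
  have h1' : ∑ v, (ndegree G v : ℤ) = 2 * Nat.card G.edgeSet := by exact_mod_cast h1
  have h2' : 2 * (Nat.card G.lineGraph.edgeSet : ℤ) + 2 * Nat.card G.edgeSet =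
    ∑ v, (ndegree G v : ℤ) ^ 2 := by exact_mod_cast h2
  rw [h3, h1', ← h2']
  ring

theorem excess_nonneg (d : ℕ) : 0 ≤ ((d : ℤ) - 1) * (d - 2) := by
  rcases le_or_gt d 1 with h | h
  · interval_cases d <;> norm_num
  · have : (2 : ℤ) ≤ d := by exact_mod_cast h
    exact mul_nonneg (by linarith) (by linarith)

theorem excess_ge {d k : ℕ} (hk : 2 ≤ k) (h : k ≤ d) :
    ((k : ℤ) - 1) * (k - 2) ≤ ((d : ℤ) - 1) * (d - 2) := by
  have h1 : (k : ℤ) ≤ d := by exact_mod_cast h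
  have h2 : (2 : ℤ) ≤ k := by exact_mod_cast hk
  exact mul_le_mul (by linarith) (by linarith) (by linarith) (by linarith)

/-- Convexity of the orders of `G`, `L(G)`, `L(L(G))`. The three variants that follow keep the
contribution of one or two branch vertices: half of `(d-1)(d-2)` is at least 1 for `d ≥ 3` and at
least 3 for `d ≥ 4`. -/
theorem two_mul_card_edgeSet_le [Finite V] :
    2 * Nat.card G.edgeSet ≤ Nat.card G.lineGraph.edgeSet + Nat.card V := by
  have := Fintype.ofFinite V
  have h := sum_excess (G := G)
  have h' := Finset.sum_nonneg fun v (_ : v ∈ Finset.univ) => excess_nonneg (ndegree G v)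
  omega

theorem two_mul_card_edgeSet_lt [Finite V] {c : V} (hc : 3 ≤ ndegree G c) :
    2 * Nat.card G.edgeSet + 1 ≤ Nat.card G.lineGraph.edgeSet + Nat.card V := by
  have := Fintype.ofFinite V
  have h := sum_excess (G := G)
  have h' := Finset.single_le_sum (fun v _ => excess_nonneg (ndegree G v)) (Finset.mem_univ c)
  have h'' := excess_ge (by norm_num) hc
  norm_num at h''
  omega

theorem two_mul_card_edgeSet_add_three_le [Finite V] {c : V} (hc : 4 ≤ ndegree G c) :
    2 * Nat.card G.edgeSet + 3 ≤ Nat.card G.lineGraph.edgeSet + Nat.card V := by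
  have := Fintype.ofFinite V
  have h := sum_excess (G := G)
  have h' := Finset.single_le_sum (fun v _ => excess_nonneg (ndegree G v)) (Finset.mem_univ c)
  have h'' := excess_ge (by norm_num) hc
  norm_num at h''
  omega

theorem two_mul_card_edgeSet_add_two_le [Finite V] {c c' : V} (hcc : c ≠ c')
    (hc : 3 ≤ ndegree G c) (hc' : 3 ≤ ndegree G c') :
    2 * Nat.card G.edgeSet + 2 ≤ Nat.card G.lineGraph.edgeSet + Nat.card V := by
  classical
  have := Fintype.ofFinite V
  have h := sum_excess (G := G)
  have h' := Finset.sum_le_sum_of_subset_of_nonneg (Finset.subset_univ {c, c'})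
    (fun v _ _ => excess_nonneg (ndegree G v))
  rw [Finset.sum_pair hcc] at h'
  have h1 := excess_ge (by norm_num) hc
  have h2 := excess_ge (by norm_num) hc'
  norm_num at h1 h2
  omega

theorem exists_three_le_ndegree [Finite V] (h : Nat.card V < Nat.card G.edgeSet) :
    ∃ v, 3 ≤ ndegree G v := by
  by_contra! hcon
  have := Fintype.ofFinite V
  have h1 := sum_ndegree (G := G)
  have h2 : ∑ v, ndegree G v ≤ ∑ _v : V, 2 :=
    Finset.sum_le_sum fun v _ => Nat.lt_succ_iff.1 (hcon v)
  simp at h2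
  rw [Nat.card_eq_fintype_card (α := V)] at h
  omega

end counting

/-! ### Subdivisions of the claw: degrees and counting -/

section claw
variable {m : Fin 3 → ℕ}

theorem claw_adj_none_some {i : Fin 3} {j : Fin (m i)} :
    (subdividedClaw m).Adj none (some ⟨i, j⟩) ↔ j.val = 0 := by
  simp [subdividedClaw]

theorem claw_adj_some_some {i i' : Fin 3} {j : Fin (m i)} {j' : Fin (m i')} :
    (subdividedClaw m).Adj (some ⟨i, j⟩) (some ⟨i', j'⟩) ↔
      i = i' ∧ (j'.val = j.val + 1 ∨ j.val = j'.val + 1) := by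
  simp only [subdividedClaw, fromRel_adj]
  constructor
  · rintro ⟨_, ⟨h, h'⟩ | ⟨h, h'⟩⟩
    · exact ⟨h, Or.inl h'⟩
    · exact ⟨h.symm, Or.inr h'⟩
  · rintro ⟨rfl, h⟩
    refine ⟨fun h' => ?_, h.imp (fun h => ⟨rfl, h⟩) fun h => ⟨rfl, h⟩⟩
    simp only [Option.some.injEq, Sigma.mk.injEq, heq_eq_eq, true_and] at h'
    subst h'
    omega

/-- The neighbour of a vertex of an arm on the side of the centre. -/
def clawParent (x : Σ i : Fin 3, Fin (m i)) : Option (Σ i : Fin 3, Fin (m i)) :=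
  if x.2.val = 0 then none else some ⟨x.1, ⟨x.2.val - 1, by omega⟩⟩

theorem claw_adj_parent (x : Σ i : Fin 3, Fin (m i)) :
    (subdividedClaw m).Adj (clawParent x) (some x) := by
  obtain ⟨i, j⟩ := x
  unfold clawParent
  split_ifs with h
  · exact claw_adj_none_some.2 h
  · refine claw_adj_some_some.2 ⟨rfl, Or.inl ?_⟩
    simp only at h ⊢
    omega

theorem eq_clawParent_or_of_adj {x : Σ i : Fin 3, Fin (m i)} {w : Option (Σ i : Fin 3, Fin (m i))}
    (h : (subdividedClaw m).Adj (some x) w) :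
    w = clawParent x ∨ ∃ h : x.2.val + 1 < m x.1, w = some ⟨x.1, ⟨x.2.val + 1, h⟩⟩ := by
  obtain ⟨i, j⟩ := x
  rcases w with _ | ⟨i', j'⟩
  · left
    rw [adj_comm, claw_adj_none_some] at h
    simp [clawParent, h]
  · rw [claw_adj_some_some] at h
    obtain ⟨rfl, h | h⟩ := h
    · right
      refine ⟨by have := j'.isLt; simp only; omega, ?_⟩
      simp [Fin.ext_iff, h]
    · left
      simp [clawParent, h]

theorem eq_clawParent_of_adj {x y : Σ i : Fin 3, Fin (m i)}
    (h : (subdividedClaw m).Adj (some x) (some y)) :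
    some x = clawParent y ∨ some y = clawParent x := by
  obtain ⟨i, j⟩ := x
  obtain ⟨i', j'⟩ := y
  rw [claw_adj_some_some] at h
  obtain ⟨rfl, h | h⟩ := h
  · left
    simp [clawParent, h]
  · right
    simp [clawParent, h]

/-- The edges of a subdivided claw correspond to the vertices other than the centre. -/
noncomputable def clawEdgeEquiv (m : Fin 3 → ℕ) :
    (Σ i : Fin 3, Fin (m i)) ≃ (subdividedClaw m).edgeSet := by
  refine Equiv.ofBijective (fun x => ⟨s(clawParent x, some x), claw_adj_parent x⟩) ⟨?_, ?_⟩
  · intro x y h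
    have h1 : s(clawParent x, some x) = s(clawParent y, some y) := congrArg Subtype.val h
    rw [Sym2.eq_iff] at h1
    rcases h1 with ⟨_, h⟩ | ⟨h, h'⟩
    · exact Option.some_injective _ h
    · obtain ⟨i, j⟩ := x
      obtain ⟨i', j'⟩ := y
      unfold clawParent at h h'
      split_ifs at h h' with h0 h0'
      simp only [Option.some.injEq, Sigma.mk.injEq] at h h'
      obtain ⟨rfl, h⟩ := h
      simp only [heq_eq_eq, true_and, Fin.ext_iff] at h h'
      simp only at h0 h0'
      omega
  · rintro ⟨e, he⟩
    induction e with
    | h a b =>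
      rcases a with _ | x <;> rcases b with _ | y
      · exact absurd (show (subdividedClaw m).Adj none none from he) (SimpleGraph.irrefl _)
      · refine ⟨y, Subtype.ext ?_⟩
        have := claw_adj_none_some.1 (show (subdividedClaw m).Adj none (some ⟨y.1, y.2⟩) from he)
        simp [clawParent, this]
      · refine ⟨x, Subtype.ext ?_⟩
        have := claw_adj_none_some.1
          (show (subdividedClaw m).Adj none (some ⟨x.1, x.2⟩) from Adj.symm he)
        simp [clawParent, this]
      · rcases eq_clawParent_of_adj he with h | h
        · exact ⟨y, Subtype.ext (by simp [h])⟩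
        · exact ⟨x, Subtype.ext (by simp [h, Sym2.eq_swap])⟩

theorem card_claw_vert : Nat.card (Option (Σ i : Fin 3, Fin (m i))) = m 0 + m 1 + m 2 + 1 := by
  simp [Fin.sum_univ_three]

theorem card_claw_edgeSet : Nat.card (subdividedClaw m).edgeSet = m 0 + m 1 + m 2 := by
  rw [← Nat.card_congr (clawEdgeEquiv m)]
  simp [Fin.sum_univ_three]

theorem ndegree_claw_none (hm : ∀ i, 1 ≤ m i) : ndegree (subdividedClaw m) none = 3 := by
  have : (subdividedClaw m).neighborSet none = Set.range fun i : Fin 3 => some ⟨i, ⟨0, hm i⟩⟩ := by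
    ext w
    rcases w with _ | ⟨i, j⟩
    · simp
    · rw [mem_neighborSet, claw_adj_none_some]
      constructor
      · intro h
        exact ⟨i, by simp [Fin.ext_iff, h]⟩
      · rintro ⟨i', h⟩
        simp only [Option.some.injEq, Sigma.mk.injEq] at h
        obtain ⟨rfl, h⟩ := h
        rw [← eq_of_heq h]
  rw [ndegree, this, ← Nat.card_coe_set_eq, Nat.card_range_of_injective]
  · simp
  · intro i i' h
    simp only [Option.some.injEq, Sigma.mk.injEq] at h
    exact h.1

theorem ndegree_claw_some (x : Σ i : Fin 3, Fin (m i)) :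
    ndegree (subdividedClaw m) (some x) = if x.2.val + 1 < m x.1 then 2 else 1 := by
  split_ifs with h
  · have : (subdividedClaw m).neighborSet (some x) =
        {clawParent x, some ⟨x.1, ⟨x.2.val + 1, h⟩⟩} := by
      ext w
      constructor
      · intro hw
        rcases eq_clawParent_or_of_adj hw with h | ⟨_, h⟩
        · exact Or.inl h
        · exact Or.inr h
      · rintro (rfl | rfl)
        · exact (claw_adj_parent x).symm
        · exact claw_adj_some_some.2 ⟨rfl, Or.inl rfl⟩
    rw [ndegree, this, Set.ncard_pair]
    unfold clawParent
    split_ifs with h0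
    · simp
    · simp only [ne_eq, Option.some.injEq, Sigma.mk.injEq, heq_eq_eq, true_and, Fin.mk.injEq]
      omega
  · have : (subdividedClaw m).neighborSet (some x) = {clawParent x} := by
      ext w
      constructor
      · intro hw
        rcases eq_clawParent_or_of_adj hw with h' | ⟨h', _⟩
        · exact h'
        · exact absurd h' h
      · rintro rfl
        exact (claw_adj_parent x).symm
    rw [ndegree, this, Set.ncard_singleton]

/-- Only the centre, of degree 3, has a nonzero term in `sum_excess`. -/
theorem card_claw_lineGraph_edgeSet (hm : ∀ i, 1 ≤ m i) :
    Nat.card (subdividedClaw m).lineGraph.edgeSet = m 0 + m 1 + m 2 := by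
  have h := sum_excess (G := subdividedClaw m)
  rw [Fintype.sum_option, ndegree_claw_none hm, Finset.sum_eq_zero, card_claw_edgeSet,
    card_claw_vert] at h
  · push_cast at h
    omega
  · intro x _
    rw [ndegree_claw_some]
    split_ifs <;> simp

/-- The number of arms with at least two edges. -/
def longArms (m : Fin 3 → ℕ) : ℕ := ∑ i, if 2 ≤ m i then 1 else 0

theorem ndegree_lineGraph_clawEdgeEquiv (hm : ∀ i, 1 ≤ m i) (x : Σ i : Fin 3, Fin (m i)) :
    ndegree (subdividedClaw m).lineGraph (clawEdgeEquiv m x) =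
      (if x.2.val = 0 then 2 else 1) + if x.2.val + 1 < m x.1 then 1 else 0 := by
  have h := ndegree_lineGraph (claw_adj_parent x)
  have h' : ndegree (subdividedClaw m) (clawParent x) = if x.2.val = 0 then 3 else 2 := by
    unfold clawParent
    split_ifs with h0
    · exact ndegree_claw_none hm
    · rw [ndegree_claw_some, if_pos]
      simp only
      omega
  rw [h', ndegree_claw_some] at h
  change ndegree (subdividedClaw m).lineGraph ⟨s(clawParent x, some x), claw_adj_parent x⟩ = _
  split_ifs at h ⊢ <;> omega

/-- The line graph is a triangle with paths attached. Its vertices of degree 3 are the first edges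
of the long arms, and all its other degrees are 1 or 2. -/
theorem card_claw_lineGraph_lineGraph_edgeSet (hm : ∀ i, 1 ≤ m i) :
    Nat.card (subdividedClaw m).lineGraph.lineGraph.edgeSet =
      m 0 + m 1 + m 2 + longArms m := by
  classical
  have h := sum_excess (G := (subdividedClaw m).lineGraph)
  rw [← (clawEdgeEquiv m).sum_comp, Fintype.sum_sigma] at h
  have key : ∀ i, ∑ j : Fin (m i),
      ((ndegree (subdividedClaw m).lineGraph (clawEdgeEquiv m ⟨i, j⟩) : ℤ) - 1) *
        (ndegree (subdividedClaw m).lineGraph (clawEdgeEquiv m ⟨i, j⟩) - 2) =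
      2 * if 2 ≤ m i then 1 else 0 := by
    intro i
    rw [Finset.sum_eq_single (⟨0, hm i⟩ : Fin (m i))]
    · rw [ndegree_lineGraph_clawEdgeEquiv hm]
      by_cases h2 : 2 ≤ m i
      · simp [h2, show 1 < m i by omega]
      · simp [h2, show ¬ 1 < m i by omega]
    · intro j _ hj
      rw [ndegree_lineGraph_clawEdgeEquiv hm]
      have : j.val ≠ 0 := fun h => hj (Fin.ext h)
      simp only [this, if_false]
      split_ifs <;> simp
    · simp
  rw [Finset.sum_congr rfl fun i _ => key i, ← Finset.mul_sum, card_claw_edgeSet,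
    card_claw_lineGraph_edgeSet hm] at h
  have h' : (longArms m : ℤ) = ∑ i, if 2 ≤ m i then 1 else 0 := by
    simp [longArms]
  rw [← h'] at h
  push_cast at h
  omega

theorem centreLeaves_add_longArms (hm : ∀ i, 1 ≤ m i) : centreLeaves m + longArms m = 3 := by
  have h1 : {w | (subdividedClaw m).Adj none w ∧ ((subdividedClaw m).neighborSet w).ncard = 1} =
      (fun i : Fin 3 => some ⟨i, ⟨0, hm i⟩⟩) '' {i | m i = 1} := by
    ext w
    constructor
    · rintro ⟨h, h'⟩
      rcases w with _ | ⟨i, j⟩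
      · exact absurd h (SimpleGraph.irrefl _)
      · rw [claw_adj_none_some] at h
        change ndegree (subdividedClaw m) (some ⟨i, j⟩) = 1 at h'
        rw [ndegree_claw_some] at h'
        refine ⟨i, ?_, by simp [Fin.ext_iff, h]⟩
        have := hm i
        simp only [h] at h'
        change m i = 1
        split_ifs at h' <;> omega
    · rintro ⟨i, hi, rfl⟩
      refine ⟨claw_adj_none_some.2 rfl, ?_⟩
      change ndegree (subdividedClaw m) _ = 1
      rw [ndegree_claw_some, if_neg]
      have : m i = 1 := hi
      simp [this]
  have h2 : centreLeaves m = ∑ i, if m i = 1 then 1 else 0 := by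
    rw [centreLeaves, h1, Set.ncard_image_of_injective]
    · rw [Set.ncard_eq_toFinset_card']
      simp
    · intro i i' h
      simp only [Option.some.injEq, Sigma.mk.injEq] at h
      exact h.1
  rw [h2, longArms, ← Finset.sum_add_distrib, Finset.sum_congr rfl (g := fun _ => 1)]
  · simp
  · intro i _
    have := hm i
    split_ifs <;> omega

end claw

/-! ### Graphs of maximum degree two, and trees with a single branch vertex of degree three -/

section branching
variable {V : Type u} {G : SimpleGraph V}

theorem exists_adj_boundary (hG : G.Connected) {s : Set V} (hs : s.Nonempty) {z : V} (hz : z ∉ s) :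
    ∃ x ∈ s, ∃ y ∉ s, G.Adj x y := by
  obtain ⟨a, ha⟩ := hs
  obtain ⟨p⟩ := hG.preconnected a z
  obtain ⟨d, _, h1, h2⟩ := p.exists_boundary_dart s ha hz
  exact ⟨d.fst, h1, d.snd, h2, d.adj⟩

theorem three_le_ndegree [Finite V] {x a b c : V} (ha : G.Adj x a) (hb : G.Adj x b) (hc : G.Adj x c)
    (hab : a ≠ b) (hac : a ≠ c) (hbc : b ≠ c) : 3 ≤ ndegree G x :=
  (Set.two_lt_ncard_iff (Set.toFinite _)).2 ⟨a, b, c, ha, hb, hc, hab, hac, hbc⟩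

/-- The first `k` values of `f` are the vertices of a path. -/
def IsPathSeq (G : SimpleGraph V) (k : ℕ) (f : ℕ → V) : Prop :=
  Set.InjOn f (Set.Iio k) ∧ ∀ i, i + 1 < k → G.Adj (f i) (f (i + 1))

theorem IsPathSeq.le_card [Finite V] {k : ℕ} {f : ℕ → V} (h : IsPathSeq G k f) :
    k ≤ Nat.card V := by
  have h1 := Set.InjOn.ncard_image h.1
  have h2 := Set.ncard_le_card (f '' Set.Iio k)
  have h3 : (Set.Iio k).ncard = k := by
    simp [Set.ncard_eq_toFinset_card']
  omega

theorem IsPathSeq.snoc {k : ℕ} {f : ℕ → V} (h : IsPathSeq G k f) {y : V}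
    (hy : ∀ i < k, f i ≠ y) (hadj : 0 < k → G.Adj (f (k - 1)) y) :
    IsPathSeq G (k + 1) (fun i => if i = k then y else f i) := by
  refine ⟨fun i hi j hj hij => ?_, fun i hi => ?_⟩
  · simp only [Set.mem_Iio] at hi hj
    by_cases h1 : i = k <;> by_cases h2 : j = k
    · rw [h1, h2]
    · simp only [h1, h2, if_true, if_false] at hij
      exact absurd hij.symm (hy j (by omega))
    · simp only [h1, h2, if_true, if_false] at hij
      exact absurd hij (hy i (by omega))
    · simp only [h1, h2, if_false] at hij
      exact h.1 (Set.mem_Iio.2 (by omega)) (Set.mem_Iio.2 (by omega)) hij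
  · have h1 : i ≠ k := by omega
    by_cases h2 : i + 1 = k
    · subst h2
      simpa using hadj (by omega)
    · simp only [h1, h2, if_false]
      exact h.2 i (by omega)

theorem IsPathSeq.reverse {k : ℕ} {f : ℕ → V} (h : IsPathSeq G k f) :
    IsPathSeq G k (fun i => f (k - 1 - i)) := by
  refine ⟨fun i hi j hj hij => ?_, fun i hi => ?_⟩
  · simp only [Set.mem_Iio] at hi hj
    have := h.1 (Set.mem_Iio.2 (by omega)) (Set.mem_Iio.2 (by omega)) hij
    omega
  · have := h.2 (k - 1 - (i + 1)) (by omega)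
    rw [show k - 1 - (i + 1) + 1 = k - 1 - i by omega] at this
    exact this.symm

/-- In a connected graph of maximum degree at most two, some path visits all vertices. -/
theorem exists_spanning_pathSeq [Finite V] (hG : G.Connected) (hd : ∀ v, ndegree G v ≤ 2) :
    ∃ k f, IsPathSeq G k f ∧ 0 < k ∧ ∀ v, ∃ i < k, f i = v := by
  classical
  let P : ℕ → Prop := fun k => ∃ f, IsPathSeq G k f
  -- A path with the most vertices is taken. An edge leaving it from an end would lengthen it; one
  -- leaving from an inner vertex would give that vertex degree 3.
  have hP1 : P 1 := by
    obtain ⟨v⟩ := hG.nonempty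
    exact ⟨fun _ => v, fun i hi j hj _ => by simp at hi hj; omega, fun i hi => by omega⟩
  have hcard : 1 ≤ Nat.card V := by
    obtain ⟨f, hf⟩ := hP1
    exact hf.le_card
  have hk1 : 1 ≤ Nat.findGreatest P (Nat.card V) := Nat.le_findGreatest hcard hP1
  obtain ⟨f, hf⟩ : P (Nat.findGreatest P (Nat.card V)) := Nat.findGreatest_spec hcard hP1
  have hmax : ∀ g, ¬ IsPathSeq G (Nat.findGreatest P (Nat.card V) + 1) g := by
    intro g hg
    have := Nat.le_findGreatest hg.le_card (show P _ from ⟨g, hg⟩)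
    omega
  generalize Nat.findGreatest P (Nat.card V) = k at hk1 hf hmax
  refine ⟨k, f, hf, hk1, fun v => ?_⟩
  by_contra hv
  obtain ⟨x, ⟨i, hi, rfl⟩, y, hy, hxy⟩ := exists_adj_boundary hG (s := f '' Set.Iio k)
    ⟨f 0, 0, hk1, rfl⟩ (z := v) (fun ⟨i, hi, h⟩ => hv ⟨i, hi, h⟩)
  have hi : i < k := hi
  have hne : ∀ i < k, f i ≠ y := fun i hi h => hy ⟨i, hi, h⟩
  by_cases hl : i = k - 1
  · exact hmax _ (hf.snoc hne fun _ => hl ▸ hxy)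
  by_cases h0 : i = 0
  · refine hmax _ (hf.reverse.snoc (fun i hi => hne _ (by omega)) fun _ => ?_)
    rw [show k - 1 - (k - 1) = 0 by omega, ← h0]
    exact hxy
  have h1 := hf.2 (i - 1) (by omega)
  rw [show i - 1 + 1 = i by omega] at h1
  have := three_le_ndegree h1.symm (hf.2 i (by omega)) hxy
    (fun h => by
      have := hf.1 (Set.mem_Iio.2 (by omega)) (Set.mem_Iio.2 (by omega)) h
      omega) (hne _ (by omega)) (hne _ (by omega))
  have := hd (f i)
  omega

theorem cycleGraph_adj_of_lt {k : ℕ} {i j : Fin k} (h : i < j) :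
    (cycleGraph k).Adj i j ↔ j.val = i.val + 1 ∨ i.val = 0 ∧ j.val = k - 1 := by
  have h' : i.val < j.val := h
  rw [cycleGraph_adj', Fin.coe_sub_iff_lt.2 h, Fin.sub_val_of_le h.le]
  have := j.isLt
  omega

theorem path_or_cycle_of_ndegree_le_two [Finite V] (hG : G.Connected) (hd : ∀ v, ndegree G v ≤ 2) :
    (∃ k, Nonempty (G ≃g pathGraph k)) ∨ ∃ k, 3 ≤ k ∧ Nonempty (G ≃g cycleGraph k) := by
  obtain ⟨k, f, hf, hk, hsurj⟩ := exists_spanning_pathSeq hG hd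
  have inj : ∀ {i j}, i < k → j < k → f i = f j → i = j := fun hi hj h => hf.1 hi hj h
  have hbij : Function.Bijective (fun i : Fin k => f i) :=
    ⟨fun i j h => Fin.ext (inj i.2 j.2 h), fun v => let ⟨i, hi, h⟩ := hsurj v; ⟨⟨i, hi⟩, h⟩⟩
  -- Any chord of the spanning path other than the one joining its two ends has an inner vertex as
  -- an end, which would then have degree 3.
  have hext : ∀ i j, i < j → j < k → G.Adj (f i) (f j) → j = i + 1 ∨ i = 0 ∧ j = k - 1 := by
    intro i j hij hj hadj
    by_contra! hcon
    by_cases h0 : i = 0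
    · subst h0
      have hjl := hcon.2 rfl
      have h1 := hf.2 (j - 1) (by omega)
      rw [show j - 1 + 1 = j by omega] at h1
      have := three_le_ndegree h1.symm (hf.2 j (by omega)) hadj.symm
        (fun h => by have := inj (by omega) (by omega) h; omega)
        (fun h => by have := inj (by omega) (by omega) h; omega)
        (fun h => by have := inj (by omega) (by omega) h; omega)
      have := hd (f j)
      omega
    · have h1 := hf.2 (i - 1) (by omega)
      rw [show i - 1 + 1 = i by omega] at h1
      have := three_le_ndegree h1.symm (hf.2 i (by omega)) hadj
        (fun h => by have := inj (by omega) (by omega) h; omega)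
        (fun h => by have := inj (by omega) (by omega) h; omega)
        (fun h => by have := inj (by omega) (by omega) h; omega)
      have := hd (f i)
      omega
  -- For `k = 2` the closing edge is the path edge itself, so `3 ≤ k` is part of the condition.
  by_cases hc : 3 ≤ k ∧ G.Adj (f 0) (f (k - 1))
  · right
    refine ⟨k, hc.1, ⟨(RelIso.symm ⟨Equiv.ofBijective _ hbij, ?_⟩)⟩⟩
    have key : ∀ i j : Fin k, i < j → (G.Adj (f i) (f j) ↔ (cycleGraph k).Adj i j) := by
      intro i j hij
      rw [cycleGraph_adj_of_lt hij]
      refine ⟨hext i j hij j.2, ?_⟩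
      rintro (h | ⟨h, h'⟩)
      · rw [h]
        exact hf.2 _ (by omega)
      · rw [h, h']
        exact hc.2
    intro i j
    change G.Adj (f i) (f j) ↔ _
    rcases lt_trichotomy i j with h | rfl | h
    · exact key i j h
    · simp
    · rw [adj_comm, key j i h, adj_comm]
  · left
    refine ⟨k, ⟨(RelIso.symm ⟨Equiv.ofBijective _ hbij, ?_⟩)⟩⟩
    intro i j
    rw [pathGraph_adj]
    change G.Adj (f i) (f j) ↔ _
    constructor
    · intro h
      rcases lt_trichotomy i.val j.val with hij | hij | hij
      · rcases hext i j hij j.2 h with h1 | ⟨h1, h2⟩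
        · omega
        · left
          by_contra hne
          exact hc ⟨by omega, by rwa [h1, h2] at h⟩
      · rw [hij] at h
        exact absurd h (SimpleGraph.irrefl _)
      · rcases hext j i hij i.2 h.symm with h1 | ⟨h1, h2⟩
        · omega
        · right
          by_contra hne
          exact hc ⟨by omega, by rw [h1, h2] at h; exact h.symm⟩
    · rintro (h | h)
      · rw [← h]
        exact hf.2 _ (by omega)
      · rw [← h]
        exact (hf.2 _ (by omega)).symm

/-- Three paths with `m 0`, `m 1`, `m 2` edges that start in `c` and are otherwise disjoint. -/
structure IsSpider (G : SimpleGraph V) (c : V) (m : Fin 3 → ℕ) (f : Fin 3 → ℕ → V) : Prop where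
  zero : ∀ i, f i 0 = c
  adj : ∀ i j, j < m i → G.Adj (f i j) (f i (j + 1))
  ne_centre : ∀ i j, j < m i → f i (j + 1) ≠ c
  inj : ∀ i j i' j', j < m i → j' < m i' → f i (j + 1) = f i' (j' + 1) → i = i' ∧ j = j'

/-- The map from the subdivided claw given by a spider. -/
def spiderMap (c : V) (m : Fin 3 → ℕ) (f : Fin 3 → ℕ → V) :
    Option (Σ i : Fin 3, Fin (m i)) → V
  | none => c
  | some ⟨i, j⟩ => f i (j.val + 1)

variable {c : V} {m : Fin 3 → ℕ} {f : Fin 3 → ℕ → V}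

theorem IsSpider.injective (h : IsSpider G c m f) : Function.Injective (spiderMap c m f) := by
  rintro (_ | ⟨i, j⟩) (_ | ⟨i', j'⟩) he
  · rfl
  · exact absurd he.symm (h.ne_centre i' j' j'.2)
  · exact absurd he (h.ne_centre i j j.2)
  · obtain ⟨rfl, h2⟩ := h.inj i j i' j' j.2 j'.2 he
    rw [Fin.ext h2]

theorem IsSpider.map_adj (h : IsSpider G c m f) {x y : Option (Σ i : Fin 3, Fin (m i))}
    (hxy : (subdividedClaw m).Adj x y) : G.Adj (spiderMap c m f x) (spiderMap c m f y) := by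
  have h0 : ∀ i (j : Fin (m i)), j.val = 0 → G.Adj c (f i (j.val + 1)) := by
    intro i j hj
    have := h.adj i j j.2
    rw [hj, h.zero i] at this
    rwa [hj]
  rcases x with _ | ⟨i, j⟩ <;> rcases y with _ | ⟨i', j'⟩
  · exact absurd hxy (SimpleGraph.irrefl _)
  · exact h0 i' j' (claw_adj_none_some.1 hxy)
  · exact (h0 i j (claw_adj_none_some.1 hxy.symm)).symm
  · obtain ⟨rfl, h1 | h1⟩ := claw_adj_some_some.1 hxy
    · have := h.adj i (j.val + 1) (h1 ▸ j'.2)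
      change G.Adj (f i (j.val + 1)) (f i (j'.val + 1))
      rwa [h1]
    · have := h.adj i (j'.val + 1) (h1 ▸ j.2)
      change G.Adj (f i (j.val + 1)) (f i (j'.val + 1))
      rw [h1]
      exact this.symm

theorem IsSpider.sum_lt_card [Finite V] (h : IsSpider G c m f) :
    m 0 + m 1 + m 2 < Nat.card V := by
  have := Nat.card_le_card_of_injective _ h.injective
  rw [card_claw_vert] at this
  omega

theorem IsSpider.extend (h : IsSpider G c m f) {i : Fin 3} {y : V} (hy : G.Adj (f i (m i)) y)
    (hc : y ≠ c) (hne : ∀ i j, j < m i → f i (j + 1) ≠ y) :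
    IsSpider G c (Function.update m i (m i + 1))
      (Function.update f i (Function.update (f i) (m i + 1) y)) := by
  have hlow : ∀ i' j, j ≤ m i' →
      Function.update f i (Function.update (f i) (m i + 1) y) i' j = f i' j := by
    intro i' j hj
    by_cases hi : i' = i
    · subst hi
      rw [Function.update_self, Function.update_of_ne (by omega)]
    · rw [Function.update_of_ne hi]
  have htop : Function.update f i (Function.update (f i) (m i + 1) y) i (m i + 1) = y := by
    simp
  have hcase : ∀ i' j, j < Function.update m i (m i + 1) i' → j < m i' ∨ i' = i ∧ j = m i := by
    intro i' j hj
    by_cases hi : i' = i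
    · subst hi
      rw [Function.update_self] at hj
      omega
    · rw [Function.update_of_ne hi] at hj
      exact Or.inl hj
  refine ⟨fun i' => ?_, fun i' j hj => ?_, fun i' j hj => ?_, fun i₁ j₁ i₂ j₂ h₁ h₂ he => ?_⟩
  · rw [hlow _ _ (Nat.zero_le _), h.zero]
  · rcases hcase i' j hj with h1 | ⟨rfl, rfl⟩
    · rw [hlow _ _ h1.le, hlow _ _ h1]
      exact h.adj _ _ h1
    · rwa [hlow _ _ le_rfl, htop]
  · rcases hcase i' j hj with h1 | ⟨rfl, rfl⟩
    · rw [hlow _ _ h1]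
      exact h.ne_centre _ _ h1
    · rwa [htop]
  · rcases hcase i₁ j₁ h₁ with h1 | ⟨rfl, rfl⟩ <;> rcases hcase i₂ j₂ h₂ with h2 | ⟨h2, h3⟩
    · rw [hlow _ _ h1, hlow _ _ h2] at he
      exact h.inj _ _ _ _ h1 h2 he
    · subst h2 h3
      rw [hlow _ _ h1, htop] at he
      exact absurd he (hne _ _ h1)
    · rw [hlow _ _ h2, htop] at he
      exact absurd he.symm (hne _ _ h2)
    · exact ⟨h2.symm, h3.symm⟩

theorem exists_spider [Finite V] (hc : 3 ≤ ndegree G c) : ∃ f, IsSpider G c (fun _ => 1) f := by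
  obtain ⟨a, b, d, ha, hb, hd, hab, had, hbd⟩ := (Set.two_lt_ncard_iff (Set.toFinite _)).1 hc
  have hadj : ∀ i, G.Adj c (![a, b, d] i) := by
    intro i
    fin_cases i
    · exact ha
    · exact hb
    · exact hd
  refine ⟨fun i j => if j = 0 then c else ![a, b, d] i, fun _ => rfl, fun i j hj => ?_,
    fun i j _ => (hadj i).ne', fun i j i' j' hj hj' he => ⟨?_, by omega⟩⟩
  · obtain rfl : j = 0 := by omega
    exact hadj i
  · simp only [Nat.add_eq_zero_iff, one_ne_zero, and_false, if_false] at he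
    fin_cases i <;> fin_cases i' <;> simp_all

/-- The induced map on edges is injective, and the edge count makes it surjective, so `F` also
reflects adjacency. -/
theorem iso_of_bijective_of_card_edgeSet {W : Type v} {H : SimpleGraph W} [Finite V]
    (F : W → V) (hF : Function.Bijective F) (hadj : ∀ x y, H.Adj x y → G.Adj (F x) (F y))
    (hcard : Nat.card G.edgeSet ≤ Nat.card H.edgeSet) : Nonempty (G ≃g H) := by
  let E : H.edgeSet → G.edgeSet := fun e => ⟨e.1.map F, by
    obtain ⟨e, he⟩ := e
    induction e with
    | h a b => exact hadj a b he⟩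
  have hE : Function.Injective E := fun e e' h =>
    Subtype.ext (Sym2.map.injective hF.1 (congrArg Subtype.val h))
  have : Finite W := Finite.of_injective F hF.1
  have hE' : Function.Bijective E :=
    (Nat.bijective_iff_injective_and_card E).2
      ⟨hE, le_antisymm (Nat.card_le_card_of_injective E hE) hcard⟩
  refine ⟨(RelIso.symm ⟨Equiv.ofBijective F hF, ?_⟩)⟩
  intro x y
  refine ⟨fun h => ?_, hadj x y⟩
  obtain ⟨⟨e, he⟩, h1⟩ := hE'.2 ⟨s(F x, F y), h⟩
  have h2 : e.map F = (s(x, y)).map F := congrArg Subtype.val h1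
  rw [Sym2.map.injective hF.1 h2] at he
  exact he

/-- A tree with a vertex of degree three, all other degrees being at most two, is a subdivision of
the claw. -/
theorem exists_iso_subdividedClaw [Finite V] (hG : G.Connected)
    (hcard : Nat.card G.edgeSet + 1 = Nat.card V) (hc : ndegree G c = 3)
    (hd : ∀ v, v ≠ c → ndegree G v ≤ 2) :
    ∃ m : Fin 3 → ℕ, (∀ i, 1 ≤ m i) ∧ Nonempty (G ≃g subdividedClaw m) := by
  classical
  let P : ℕ → Prop := fun s => ∃ m f, (∀ i, 1 ≤ m i) ∧ m 0 + m 1 + m 2 = s ∧ IsSpider G c m f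
  -- A spider with the largest total arm length is taken; it starts from three neighbours of `c`. By
  -- the degree bounds an edge leaving it can only start at the tip of an arm, and would then extend
  -- that arm.
  have hP3 : P 3 := by
    obtain ⟨f, hf⟩ := exists_spider hc.ge
    exact ⟨_, f, fun _ => le_rfl, rfl, hf⟩
  have hle : ∀ s, P s → s ≤ Nat.card V := by
    rintro s ⟨m, f, _, rfl, hf⟩
    exact hf.sum_lt_card.le
  obtain ⟨m, f, hm, hs, hf⟩ : P (Nat.findGreatest P (Nat.card V)) :=
    Nat.findGreatest_spec (hle 3 hP3) hP3
  have hmax : ¬ P (m 0 + m 1 + m 2 + 1) := by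
    intro h
    have := Nat.le_findGreatest (hle _ h) h
    omega
  refine ⟨m, hm, ?_⟩
  have hsurj : Function.Surjective (spiderMap c m f) := by
    intro v
    by_contra hv
    obtain ⟨x, ⟨w, rfl⟩, y, hy, hxy⟩ := exists_adj_boundary hG
      (s := Set.range (spiderMap c m f)) ⟨c, none, rfl⟩ (z := v) hv
    have hyc : y ≠ c := fun h => hy ⟨none, h.symm⟩
    have hyf : ∀ i j, j < m i → f i (j + 1) ≠ y := fun i j hj h => hy ⟨some ⟨i, ⟨j, hj⟩⟩, h⟩
    rcases w with _ | ⟨i, j⟩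
    · have hnb : ∀ i, G.Adj c (f i 1) := fun i => by
        have := hf.adj i 0 (hm i)
        rwa [hf.zero] at this
      have hsub : Set.range (fun i => f i 1) ⊆ G.neighborSet c := by
        rintro _ ⟨i, rfl⟩
        exact hnb i
      have hinj : Function.Injective (fun i => f i 1) := fun i i' h =>
        (hf.inj i 0 i' 0 (hm i) (hm i') h).1
      have h3 : (Set.range (fun i => f i 1)).ncard = 3 := by
        rw [← Nat.card_coe_set_eq, Nat.card_range_of_injective hinj]
        simp
      have heq := Set.eq_of_subset_of_ncard_le hsub (by rw [h3]; exact hc.le)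
      have : y ∈ Set.range (fun i => f i 1) := heq ▸ hxy
      obtain ⟨i, hi⟩ := this
      exact hyf i 0 (hm i) hi
    · change G.Adj (f i (j.val + 1)) y at hxy
      by_cases hl : j.val + 1 = m i
      · rw [hl] at hxy
        refine hmax ⟨_, _, fun i' => ?_, ?_, hf.extend hxy hyc hyf⟩
        · by_cases hi : i' = i
          · rw [hi, Function.update_self]
            omega
          · rw [Function.update_of_ne hi]
            exact hm i'
        · clear hl hxy j
          fin_cases i <;> simp <;> omega
      · have hj := j.2
        have := three_le_ndegree (hf.adj i j hj).symm (hf.adj i (j + 1) (by omega)) hxy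
          (fun h => ?_) (fun h => ?_) (hyf _ _ (by omega))
        · have := hd _ (hf.ne_centre i j hj)
          omega
        · rcases Nat.eq_zero_or_pos j.val with h0 | h0
          · rw [h0, hf.zero] at h
            exact hf.ne_centre i 1 (by omega) h.symm
          · have := hf.inj i (j.val - 1) i (j.val + 1) (by omega) (by omega)
              (by rwa [Nat.sub_add_cancel h0])
            omega
        · rcases Nat.eq_zero_or_pos j.val with h0 | h0
          · rw [h0, hf.zero] at h
            exact hyc h.symm
          · refine hyf i (j.val - 1) (by omega) ?_
            rwa [Nat.sub_add_cancel h0]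
  have hbij : Function.Bijective (spiderMap c m f) := ⟨hf.injective, hsurj⟩
  -- The spanning spider already has `n - 1` edges, and the tree `G` has no more.
  refine iso_of_bijective_of_card_edgeSet _ hbij (fun x y h => hf.map_adj h) ?_
  have h1 := Nat.card_eq_of_bijective _ hbij
  rw [card_claw_vert] at h1
  rw [card_claw_edgeSet]
  omega

end branching

/-! ### Matchings of subdivided claws -/

section clawMatching
variable {m : Fin 3 → ℕ}

/-- Apart from the arm holding the partner of the centre, every arm is matched within itself and so
has an even number of vertices. -/
theorem even_arms_of_perfect {σ : Option (Σ i : Fin 3, Fin (m i)) → Option (Σ i : Fin 3, Fin (m i))}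
    (hσ : IsMatchingInvolution (subdividedClaw m) σ) (hp : ∀ v, σ v ≠ v) :
    ∃ i₀, ∀ i, i ≠ i₀ → Even (m i) := by
  obtain ⟨x₀, hx₀⟩ : ∃ x, σ none = some x := Option.ne_none_iff_exists'.1 (hp none)
  refine ⟨x₀.1, fun i hi => ?_⟩
  have hex : ∀ j : Fin (m i), ∃ j' : Fin (m i), σ (some ⟨i, j⟩) = some ⟨i, j'⟩ := by
    intro j
    have hadj := hσ.2 _ (hp (some ⟨i, j⟩))
    rcases hw : σ (some ⟨i, j⟩) with _ | ⟨i', j'⟩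
    · have := hσ.1 (some ⟨i, j⟩)
      rw [hw, hx₀, Option.some.injEq] at this
      exact absurd (congrArg Sigma.fst this).symm hi
    · rw [hw, claw_adj_some_some] at hadj
      obtain ⟨rfl, _⟩ := hadj
      exact ⟨j', rfl⟩
  choose τ hτ using hex
  have hfix : ∀ j, τ j ≠ j := fun j h => hp (some ⟨i, j⟩) (by rw [hτ, h])
  -- Only the parity of the arm matters here, so the complete graph serves as host.
  have hinv : IsMatchingInvolution (⊤ : SimpleGraph (Fin (m i))) τ := by
    refine ⟨fun j => ?_, fun j h => h.symm⟩
    have := hσ.1 (some ⟨i, j⟩)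
    rw [hτ, hτ] at this
    simpa using this
  have h1 := ncard_verts_of_isMatching hinv.isMatching
  have h2 : hinv.toSubgraph.verts = Set.univ := Set.eq_univ_of_forall hfix
  rw [h2, Set.ncard_univ, Nat.card_fin] at h1
  exact ⟨_, h1.trans (two_mul _)⟩

/-- The matching that joins the centre to a leaf and pairs up consecutive vertices of the other
arms, starting next to the centre. -/
def clawInvolution (i₀ : Fin 3) (h₀ : 0 < m i₀) :
    Option (Σ i : Fin 3, Fin (m i)) → Option (Σ i : Fin 3, Fin (m i))
  | none => some ⟨i₀, ⟨0, h₀⟩⟩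
  | some ⟨i, j⟩ =>
    if i = i₀ then none
    else if j.val % 2 = 0 then
      if h : j.val + 1 < m i then some ⟨i, ⟨j.val + 1, h⟩⟩ else some ⟨i, j⟩
    else some ⟨i, ⟨j.val - 1, by omega⟩⟩

/-- `clawInvolution` sends all of arm `i₀` to the centre, hence the condition that this arm has a
single vertex. -/
theorem isMatchingInvolution_clawInvolution {i₀ : Fin 3} (h₁ : m i₀ = 1) :
    IsMatchingInvolution (subdividedClaw m) (clawInvolution i₀ (by omega)) := by
  constructor
  · rintro (_ | ⟨i, j⟩)
    · simp [clawInvolution]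
    · by_cases hi : i = i₀
      · subst hi
        have : j.val = 0 := by omega
        simp [clawInvolution, Fin.ext_iff, this]
      · by_cases hj : j.val % 2 = 0
        · by_cases hl : j.val + 1 < m i
          · have : (j.val + 1) % 2 ≠ 0 := by omega
            simp [clawInvolution, hi, hj, hl, this]
          · simp [clawInvolution, hi, hj, hl]
        · have h1 : (j.val - 1) % 2 = 0 := by omega
          have h2 : j.val - 1 + 1 = j.val := by omega
          simp [clawInvolution, hi, hj, h1, h2]
  · rintro (_ | ⟨i, j⟩) hv
    · exact claw_adj_none_some.2 rfl
    · by_cases hi : i = i₀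
      · subst hi
        have : j.val = 0 := by omega
        simpa [clawInvolution] using (claw_adj_none_some.2 this).symm
      · by_cases hj : j.val % 2 = 0
        · by_cases hl : j.val + 1 < m i
          · simp [clawInvolution, hi, hj, hl, claw_adj_some_some]
          · simp [clawInvolution, hi, hj, hl] at hv
        · have h2 : j.val = j.val - 1 + 1 := by omega
          simp [clawInvolution, hi, hj, claw_adj_some_some, ← h2]

/-- The only fixed points of `clawInvolution` are the tips of odd arms other than `i₀`. -/
theorem card_half_le_matchingNumber_claw {i₀ : Fin 3} (h₁ : m i₀ = 1)
    (hodd : {i | i ≠ i₀ ∧ Odd (m i)}.Subsingleton) :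
    (((m 0 + m 1 + m 2 + 1) / 2 : ℕ) : ℕ∞) ≤ matchingNumber ⟨_, subdividedClaw m⟩ := by
  have hfix : ∀ v, clawInvolution i₀ (by omega) v = v →
      ∃ (i : Fin 3) (j : Fin (m i)), v = some ⟨i, j⟩ ∧ i ≠ i₀ ∧ Odd (m i) ∧ j.val + 1 = m i := by
    rintro (_ | ⟨i, j⟩) hv
    · simp [clawInvolution] at hv
    · refine ⟨i, j, rfl, ?_⟩
      by_cases hi : i = i₀
      · simp [clawInvolution, hi] at hv
      · by_cases hj : j.val % 2 = 0
        · by_cases hl : j.val + 1 < m i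
          · simp [clawInvolution, hi, hj, hl, Fin.ext_iff] at hv
          · refine ⟨hi, ?_, by omega⟩
            rw [Nat.odd_iff]
            omega
        · simp [clawInvolution, hi, hj, Fin.ext_iff] at hv
          omega
  have hsub : {v | clawInvolution (m := m) i₀ (by omega) v = v}.Subsingleton := by
    intro v hv w hw
    obtain ⟨i, j, rfl, h1, h2, h3⟩ := hfix v hv
    obtain ⟨i', j', rfl, h1', h2', h3'⟩ := hfix w hw
    obtain rfl : i = i' := hodd ⟨h1, h2⟩ ⟨h1', h2'⟩
    obtain rfl : j = j' := Fin.ext (by omega)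
    rfl
  refine le_matchingNumber (isMatchingInvolution_clawInvolution h₁) ?_
  have h1 := Set.ncard_add_ncard_compl {v | clawInvolution (m := m) i₀ (by omega) v = v}
  have h2 := Set.ncard_le_one_iff_subsingleton.2 hsub
  have h3 : {v | clawInvolution (m := m) i₀ (by omega) v = v}ᶜ =
    {v | clawInvolution (m := m) i₀ (by omega) v ≠ v} := rfl
  rw [h3, card_claw_vert] at h1
  omega

/-- Permuting the arms of a subdivided claw. -/
def clawPermIso (m : Fin 3 → ℕ) (π : Equiv.Perm (Fin 3)) :
    subdividedClaw (m ∘ π) ≃g subdividedClaw m where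
  toEquiv := Equiv.optionCongr (Equiv.sigmaCongrLeft (β := fun i => Fin (m i)) π)
  map_rel_iff' := by
    rintro (_ | ⟨i, j⟩) (_ | ⟨i', j'⟩)
    · simp
    · exact claw_adj_none_some.trans
        (claw_adj_none_some (m := m ∘ π) (i := i') (j := j')).symm
    · rw [adj_comm, adj_comm (subdividedClaw (m ∘ π))]
      exact claw_adj_none_some.trans (claw_adj_none_some (m := m ∘ π) (i := i) (j := j)).symm
    · refine claw_adj_some_some.trans (Iff.trans ?_ claw_adj_some_some.symm)
      exact and_congr π.injective.eq_iff Iff.rfl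

/-- The subdivided claw without long arms is the star. -/
theorem nonempty_iso_star (hm : ∀ i, m i = 1) :
    Nonempty (subdividedClaw m ≃g completeBipartiteGraph (Fin 1) (Fin 3)) := by
  obtain rfl : m = fun _ => 1 := funext hm
  refine ⟨⟨⟨fun x => x.elim (Sum.inl 0) fun y => Sum.inr y.1,
    Sum.elim (fun _ => none) fun i => some ⟨i, 0⟩, ?_, ?_⟩, ?_⟩⟩
  · rintro (_ | ⟨i, j⟩)
    · rfl
    · simp [Subsingleton.elim j 0]
  · rintro (i | i)
    · simp [Subsingleton.elim i 0]
    · rfl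
  · rintro (_ | ⟨i, j⟩) (_ | ⟨i', j'⟩)
    · simp
    · simp [claw_adj_none_some]
    · simp [adj_comm _ (some _) none, claw_adj_none_some]
    · simp [claw_adj_some_some]

end clawMatching

/-! ### The index of the matching number -/

section index
variable {V : Type u} {G : SimpleGraph V}

theorem paramIndex_le_three [Finite V] (h : G.Preconnected) {k : ℕ}
    (hk : matchingNumber ⟨V, G⟩ ≤ k) (hlt : k < Nat.card G.lineGraph.lineGraph.edgeSet / 2) :
    paramIndex matchingNumber ⟨V, G⟩ ≤ 3 := by
  refine paramIndex_le (r := 3) (hk.trans_lt (lt_of_lt_of_le ?_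
    (card_half_le_matchingNumber_lineGraph (H := G.lineGraph.lineGraph)
      (lineGraph_preconnected (lineGraph_preconnected h)))))
  exact_mod_cast hlt

theorem paramIndex_le_four [Finite V] (h : G.Preconnected)
    (hlt : Nat.card V / 2 + 1 ≤ (2 * Nat.card G.lineGraph.lineGraph.edgeSet -
      Nat.card G.lineGraph.edgeSet) / 2) :
    paramIndex matchingNumber ⟨V, G⟩ ≤ 4 := by
  have h1 := two_mul_card_edgeSet_le (G := G.lineGraph.lineGraph)
  have h2 : Nat.card V / 2 < Nat.card G.lineGraph.lineGraph.lineGraph.edgeSet / 2 := by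
    have : 2 * Nat.card G.lineGraph.lineGraph.edgeSet - Nat.card G.lineGraph.edgeSet ≤
        Nat.card G.lineGraph.lineGraph.lineGraph.edgeSet := by
      omega
    omega
  refine paramIndex_le (r := 4) (matchingNumber_le_card_half.trans_lt (lt_of_lt_of_le ?_
    (card_half_le_matchingNumber_lineGraph (H := G.lineGraph.lineGraph.lineGraph)
      (lineGraph_preconnected (lineGraph_preconnected (lineGraph_preconnected h))))))
  exact_mod_cast h2

/-- To bound the later matching numbers from above, half the order is enough; the exact values are
not needed. -/
theorem four_le_paramIndex [Finite V] {k : ℕ} (hk : (k : ℕ∞) ≤ matchingNumber ⟨V, G⟩)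
    (h1 : Nat.card G.edgeSet / 2 ≤ k) (h2 : Nat.card G.lineGraph.edgeSet / 2 ≤ k)
    (h3 : Nat.card G.lineGraph.lineGraph.edgeSet / 2 ≤ k) :
    4 ≤ paramIndex matchingNumber ⟨V, G⟩ := by
  refine le_paramIndex (k := 4) fun r hr => ?_
  interval_cases r
  · exact le_rfl
  · exact ((matchingNumber_le_card_half (G := G.lineGraph)).trans (by exact_mod_cast h1)).trans hk
  · exact ((matchingNumber_le_card_half (G := G.lineGraph.lineGraph)).trans (by exact_mod_cast h2)).trans hk
  · exact ((matchingNumber_le_card_half (G := G.lineGraph.lineGraph.lineGraph)).trans (by exact_mod_cast h3)).trans hk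

end index

/-! ### The index of subdivided claws -/

section clawIndex
variable {m : Fin 3 → ℕ}

theorem claw_connected : (subdividedClaw m).Connected := by
  have key : ∀ (k : ℕ) (i : Fin 3) (h : k < m i),
      (subdividedClaw m).Reachable none (some ⟨i, ⟨k, h⟩⟩) := by
    intro k
    induction k with
    | zero => exact fun i h => Adj.reachable (claw_adj_none_some.2 rfl)
    | succ k ih =>
      exact fun i h => (ih i (by omega)).trans
        (Adj.reachable (claw_adj_some_some.2 ⟨rfl, Or.inl rfl⟩))
  rw [connected_iff_exists_forall_reachable]
  refine ⟨none, ?_⟩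
  rintro (_ | ⟨i, j⟩)
  · exact Reachable.refl _
  · exact key j i j.2

theorem exists_short_arm (h : longArms m = 2) (hm : ∀ i, 1 ≤ m i) : ∃ a, m a = 1 := by
  by_contra! hcon
  have : longArms m = 3 := by
    simp [longArms, fun i => show 2 ≤ m i by have := hcon i; have := hm i; omega]
  omega

theorem exists_long_arm (h : longArms m = 1) (hm : ∀ i, 1 ≤ m i) :
    ∃ a, ∀ i, i ≠ a → m i = 1 := by
  by_contra! hcon
  obtain ⟨a, -, ha⟩ := hcon 0
  obtain ⟨b, hba, hb⟩ := hcon a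
  have h2 : ∑ i ∈ ({b, a} : Finset (Fin 3)), (if 2 ≤ m i then 1 else 0) ≤ longArms m :=
    Finset.sum_le_sum_of_subset (Finset.subset_univ _)
  have := hm a
  have := hm b
  rw [Finset.sum_pair hba, if_pos (by omega), if_pos (by omega)] at h2
  omega

theorem longArms_le_three : longArms m ≤ 3 := by
  unfold longArms
  rw [Fin.sum_univ_three]
  split_ifs <;> omega

theorem sum_arms (a : Fin 3) : ∃ b c, b ≠ a ∧ c ≠ a ∧ b ≠ c ∧ m 0 + m 1 + m 2 = m a + m b + m c := by
  fin_cases a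
  · exact ⟨1, 2, by decide, by decide, by decide, rfl⟩
  · exact ⟨0, 2, by decide, by decide, by decide, by simp; omega⟩
  · exact ⟨0, 1, by decide, by decide, by decide, by simp; omega⟩

theorem exists_even_arms {k : ℕ} (hk : m 0 + m 1 + m 2 + 1 = 2 * k)
    (h : (k : ℕ∞) ≤ matchingNumber ⟨_, subdividedClaw m⟩) : ∃ i₀, ∀ i, i ≠ i₀ → Even (m i) := by
  obtain ⟨σ, hσ, hp⟩ := exists_perfect_involution (card_claw_vert.trans hk) h
  exact even_arms_of_perfect hσ hp

/-- Without a perfect matching `μ ≤ n/2 - 1`, while `L^3` has at least `n` vertices. -/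
theorem claw_paramIndex_le_three_of_not_perfect (hm : ∀ i, 1 ≤ m i) {k : ℕ} (hk0 : 1 ≤ k)
    (hk : m 0 + m 1 + m 2 + 1 = 2 * k)
    (h : ¬ ∃ i₀, ∀ i, i ≠ i₀ → Even (m i)) (ht : 1 ≤ longArms m) :
    paramIndex matchingNumber ⟨_, subdividedClaw m⟩ ≤ 3 := by
  refine paramIndex_le_three (k := k - 1) claw_connected.preconnected ?_ ?_
  · have h1 : ¬ (k : ℕ∞) ≤ matchingNumber ⟨_, subdividedClaw m⟩ := fun h' =>
      h (exists_even_arms hk h')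
    rw [not_le] at h1
    obtain ⟨l, rfl⟩ := Nat.exists_eq_add_of_le' hk0
    exact Order.le_of_lt_add_one (by simpa using h1)
  · rw [card_claw_lineGraph_lineGraph_edgeSet hm]
    omega

/-- The index of a subdivided claw other than the claw itself. -/
theorem claw_paramIndex (hm : ∀ i, 1 ≤ m i) (ht : 1 ≤ longArms m) :
    paramIndex matchingNumber ⟨_, subdividedClaw m⟩ ≤ 4 ∧
      (paramIndex matchingNumber ⟨_, subdividedClaw m⟩ = 4 ↔
        longArms m = 1 ∧ Odd (m 0 + m 1 + m 2 + 1) ∨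
        longArms m = 2 ∧ ∃ a, m a = 1 ∧ ∀ i, i ≠ a → Even (m i)) := by
  have hn1 := card_claw_edgeSet (m := m)
  have hn2 := card_claw_lineGraph_edgeSet hm
  have hn3 := card_claw_lineGraph_lineGraph_edgeSet hm
  have hn := card_claw_vert (m := m)
  have hpre := (claw_connected (m := m)).preconnected
  have hμ := matchingNumber_le_card_half (G := subdividedClaw m)
  have h34 : paramIndex matchingNumber ⟨_, subdividedClaw m⟩ ≤ 3 →
      paramIndex matchingNumber ⟨_, subdividedClaw m⟩ ≠ 4 := by
    intro h h'
    rw [h'] at h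
    exact absurd h (by decide)
  have h3le : (3 : ℕ∞) ≤ 4 := by decide
  have ht3 := longArms_le_three (m := m)
  have hm0 := hm 0
  obtain ht' | ht' | ht' : longArms m = 1 ∨ longArms m = 2 ∨ longArms m = 3 := by omega
  · obtain ⟨a, ha⟩ := exists_long_arm ht' hm
    obtain ⟨b, c, hb, hc, hbc, hsum⟩ := sum_arms (m := m) a
    have hmb := ha b hb
    have hmc := ha c hc
    rcases Nat.even_or_odd (m 0 + m 1 + m 2 + 1) with hev | hodd
    · have h3 : paramIndex matchingNumber ⟨_, subdividedClaw m⟩ ≤ 3 := by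
        obtain ⟨k, hk⟩ := hev
        refine claw_paramIndex_le_three_of_not_perfect hm (k := k) (by omega) (by omega) ?_ ht
        rintro ⟨i₀, h⟩
        by_cases hbi : b = i₀
        · have := h c (fun h => hbc (hbi.trans h.symm))
          rw [hmc] at this
          exact absurd this (by decide)
        · have := h b hbi
          rw [hmb] at this
          exact absurd this (by decide)
      refine ⟨h3.trans h3le, iff_of_false (h34 h3) ?_⟩
      rintro (⟨_, h⟩ | ⟨h, _⟩)
      · exact (Nat.not_even_iff_odd.2 h) hev
      · omega
    · have h4 : paramIndex matchingNumber ⟨_, subdividedClaw m⟩ ≤ 4 := by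
        refine paramIndex_le_four hpre ?_
        rw [hn, hn2, hn3, ht']
        obtain ⟨k, hk⟩ := hodd
        omega
      refine ⟨h4, iff_of_true (le_antisymm h4 ?_) (Or.inl ⟨ht', hodd⟩)⟩
      obtain ⟨k, hk⟩ := hodd
      refine four_le_paramIndex (card_half_le_matchingNumber_claw hmb ?_) ?_ ?_ ?_
      -- With arms `m a`, 1, 1 and `n` odd, the long arm is even; the centre is matched to the leaf
      -- `b`, and the leaf `c` is the only unmatched vertex.
      · have hma : ¬ Odd (m a) := by
          rw [Nat.not_odd_iff_even, Nat.even_iff]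
          omega
        have honly : ∀ i, i ≠ b → Odd (m i) → i = c := by
          intro i hib hio
          have hia : i ≠ a := fun h => hma (h ▸ hio)
          omega
        intro i hi j hj
        rw [honly i hi.1 hi.2, honly j hj.1 hj.2]
      all_goals omega
  · obtain ⟨a, ha⟩ := exists_short_arm ht' hm
    obtain ⟨b, c, hb, hc, hbc, hsum⟩ := sum_arms (m := m) a
    have h4 : paramIndex matchingNumber ⟨_, subdividedClaw m⟩ ≤ 4 := by
      refine paramIndex_le_four hpre ?_
      rw [hn, hn2, hn3, ht']
      omega
    refine ⟨h4, fun h => Or.inr ⟨ht', a, ha, ?_⟩, ?_⟩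
    · by_contra hcon
      refine h34 ?_ h
      rcases Nat.even_or_odd (m 0 + m 1 + m 2 + 1) with ⟨k, hk⟩ | ⟨k, hk⟩
      · refine claw_paramIndex_le_three_of_not_perfect hm (k := k) (by omega) (by omega) ?_ ht
        rintro ⟨i₀, hi₀⟩
        by_cases hai : a = i₀
        · exact hcon (hai ▸ hi₀)
        · have := hi₀ a hai
          rw [ha] at this
          exact absurd this (by decide)
      -- Here `n` is odd and `L^3` has `n + 1` vertices, so half the order has already grown.
      · refine paramIndex_le_three hpre hμ ?_
        rw [hn, hn3]
        omega
    · rintro (⟨h, _⟩ | ⟨_, a, ha, hev⟩)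
      · omega
      · refine le_antisymm h4 ?_
        obtain ⟨b, c, hb, hc, hbc, hsum⟩ := sum_arms (m := m) a
        obtain ⟨p, hp⟩ := hev b hb
        obtain ⟨q, hq⟩ := hev c hc
        refine four_le_paramIndex (card_half_le_matchingNumber_claw ha ?_) ?_ ?_ ?_
        · intro i hi
          exact absurd (hev i hi.1) (Nat.not_even_iff_odd.2 hi.2)
        all_goals omega
  · have h3 : paramIndex matchingNumber ⟨_, subdividedClaw m⟩ ≤ 3 := by
      refine paramIndex_le_three hpre hμ ?_
      rw [hn, hn3]
      omega
    refine ⟨h3.trans h3le, iff_of_false (h34 h3) ?_⟩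
    rintro (⟨h, _⟩ | ⟨h, _⟩) <;> omega

theorem exists_perm_arms (m : Fin 3 → ℕ) (a : Fin 3) :
    ∃ π : Equiv.Perm (Fin 3), π 2 = a ∧ m (π 1) ≤ m (π 0) := by
  rcases le_total (m (Equiv.swap 2 a 1)) (m (Equiv.swap 2 a 0)) with h | h
  · exact ⟨Equiv.swap 2 a, Equiv.swap_apply_left _ _, h⟩
  · refine ⟨(Equiv.swap 0 1).trans (Equiv.swap 2 a), ?_, ?_⟩
    · rw [Equiv.trans_apply, show Equiv.swap (0 : Fin 3) 1 2 = 2 by decide, Equiv.swap_apply_left]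
    · simpa using h

theorem longArms_comp (m : Fin 3 → ℕ) (π : Equiv.Perm (Fin 3)) : longArms (m ∘ π) = longArms m :=
  Equiv.sum_comp π fun i => if 2 ≤ m i then 1 else 0

end clawIndex

/-! ### Prolific graphs: reduction to subdivided claws and the classification -/

section prolific

theorem ndegree_pathGraph_le (k : ℕ) (v : Fin k) : ndegree (pathGraph k) v ≤ 2 := by
  by_contra! h
  obtain ⟨a, b, c, ha, hb, hc, hab, hac, hbc⟩ := (Set.two_lt_ncard_iff (Set.toFinite _)).1 h
  rw [mem_neighborSet, pathGraph_adj] at ha hb hc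
  omega

theorem ndegree_cycleGraph_le {k : ℕ} (hk : 3 ≤ k) (v : Fin k) : ndegree (cycleGraph k) v ≤ 2 := by
  obtain ⟨n, rfl⟩ := Nat.exists_eq_add_of_le' hk
  rw [ndegree_eq_degree, cycleGraph_degree_three_le]

theorem longArms_pos {V : Type u} {G : SimpleGraph V} (hG : IsProlific ⟨V, G⟩) {m : Fin 3 → ℕ}
    (hm : ∀ i, 1 ≤ m i) (e : G ≃g subdividedClaw m) : 1 ≤ longArms m := by
  by_contra! h
  refine hG.2.2.2.2 ?_
  have hm1 : ∀ i, m i = 1 := by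
    intro i
    by_contra hi
    have h1 : (if 2 ≤ m i then 1 else 0) ≤ longArms m :=
      Finset.single_le_sum (f := fun i => if 2 ≤ m i then 1 else 0) (fun _ _ => Nat.zero_le _)
        (Finset.mem_univ i)
    have := hm i
    rw [if_pos (by omega)] at h1
    omega
  obtain ⟨f⟩ := nonempty_iso_star hm1
  exact ⟨e.trans f⟩

/-- A prolific graph that is not a subdivided claw has an iterated line graph `L^3` with at least
two more vertices. -/
theorem IsProlific.claw_or_large {V : Type u} {G : SimpleGraph V} (hG : IsProlific ⟨V, G⟩) :
    (∃ m : Fin 3 → ℕ, (∀ i, 1 ≤ m i) ∧ Nonempty (G ≃g subdividedClaw m)) ∨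
      Nat.card V + 2 ≤ Nat.card G.lineGraph.lineGraph.edgeSet := by
  obtain ⟨hfin, hconn, hpath, hcycle, -⟩ := hG
  have : Finite V := hfin
  have hconn : G.Connected := hconn
  obtain ⟨c, hc⟩ : ∃ c, 3 ≤ ndegree G c := by
    by_contra! hcon
    rcases path_or_cycle_of_ndegree_le_two hconn fun v => Nat.lt_succ_iff.1 (hcon v) with
      ⟨k, h⟩ | ⟨k, hk, h⟩
    · exact hpath k h
    · exact hcycle k hk h
  have h0 := hconn.card_vert_le_card_edgeSet_add_one
  have h1 := two_mul_card_edgeSet_lt hc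
  have h2 := two_mul_card_edgeSet_le (G := G.lineGraph)
  by_cases hn : Nat.card V ≤ Nat.card G.edgeSet
  · right
    omega
  by_cases h4 : 4 ≤ ndegree G c
  · right
    have := two_mul_card_edgeSet_add_three_le h4
    omega
  by_cases h3 : ∃ c', c ≠ c' ∧ 3 ≤ ndegree G c'
  · right
    obtain ⟨c', hne, hc'⟩ := h3
    have h5 := two_mul_card_edgeSet_add_two_le hne hc hc'
    -- Convexity alone would give only `n + 1`. Now `L(G)` has `n - 1` vertices and at least `n`
    -- edges, so it has a branch vertex, which supplies the missing unit.
    obtain ⟨e, he⟩ := exists_three_le_ndegree (G := G.lineGraph) (by omega)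
    have h6 := two_mul_card_edgeSet_lt he
    omega
  · left
    push Not at h3
    exact exists_iso_subdividedClaw hconn (by omega) (by omega)
      fun v hv => Nat.lt_succ_iff.1 (h3 v hv.symm)

theorem IsProlific.paramIndex_eq_four {V : Type u} {G : SimpleGraph V} (hG : IsProlific ⟨V, G⟩)
    (h : (Odd (Nat.card V) ∧ ∃ m : Fin 3 → ℕ, IsTypeA ⟨V, G⟩ m) ∨
        (Even (Nat.card V) ∧ ∃ m : Fin 3 → ℕ, IsTypeB ⟨V, G⟩ m ∧
          m 1 ≤ m 0 ∧ m 2 < m 1 ∧ m 2 = 1 ∧ Even (m 0) ∧ Even (m 1))) :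
    paramIndex matchingNumber ⟨V, G⟩ = 4 := by
  have : Finite V := hG.1
  rcases h with ⟨hodd, m, ⟨hm, ⟨e⟩⟩, hA⟩ | ⟨-, m, ⟨⟨hm, ⟨e⟩⟩, hB⟩, -, -, h2, h0, h1⟩
  · rw [paramIndex_matchingNumber_congr (X := ⟨V, G⟩) (Y := ⟨_, subdividedClaw m⟩) e]
    refine (claw_paramIndex hm (longArms_pos hG hm e)).2.2 (Or.inl ⟨?_, ?_⟩)
    · have := centreLeaves_add_longArms hm
      omega
    · rwa [← card_claw_vert, ← Nat.card_congr e.toEquiv]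
  · rw [paramIndex_matchingNumber_congr (X := ⟨V, G⟩) (Y := ⟨_, subdividedClaw m⟩) e]
    refine (claw_paramIndex hm (longArms_pos hG hm e)).2.2 (Or.inr ⟨?_, 2, h2, fun i hi => ?_⟩)
    · have := centreLeaves_add_longArms hm
      omega
    · fin_cases i
      · exact h0
      · exact h1
      · exact absurd rfl hi

theorem IsProlific.paramIndex_classification {V : Type u} {G : SimpleGraph V}
    (hG : IsProlific ⟨V, G⟩) :
    paramIndex matchingNumber ⟨V, G⟩ ≤ 4 ∧
      (paramIndex matchingNumber ⟨V, G⟩ = 4 ↔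
        (Odd (Nat.card V) ∧ ∃ m : Fin 3 → ℕ, IsTypeA ⟨V, G⟩ m) ∨
        (Even (Nat.card V) ∧ ∃ m : Fin 3 → ℕ, IsTypeB ⟨V, G⟩ m ∧
          m 1 ≤ m 0 ∧ m 2 < m 1 ∧ m 2 = 1 ∧ Even (m 0) ∧ Even (m 1))) := by
  have : Finite V := hG.1
  suffices h : paramIndex matchingNumber ⟨V, G⟩ ≤ 4 ∧
      (paramIndex matchingNumber ⟨V, G⟩ = 4 →
        (Odd (Nat.card V) ∧ ∃ m : Fin 3 → ℕ, IsTypeA ⟨V, G⟩ m) ∨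
        (Even (Nat.card V) ∧ ∃ m : Fin 3 → ℕ, IsTypeB ⟨V, G⟩ m ∧
          m 1 ≤ m 0 ∧ m 2 < m 1 ∧ m 2 = 1 ∧ Even (m 0) ∧ Even (m 1))) from
    ⟨h.1, h.2, hG.paramIndex_eq_four⟩
  rcases hG.claw_or_large with ⟨m, hm, ⟨e⟩⟩ | hlarge
  · have hidx := claw_paramIndex hm (longArms_pos hG hm e)
    rw [← paramIndex_matchingNumber_congr (X := ⟨V, G⟩) (Y := ⟨_, subdividedClaw m⟩) e,
      ← card_claw_vert, ← Nat.card_congr e.toEquiv] at hidx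
    refine ⟨hidx.1, fun h => ?_⟩
    have hsum := centreLeaves_add_longArms hm
    rcases hidx.2.1 h with ⟨ht, hodd⟩ | ⟨ht, a, ha, hev⟩
    · exact Or.inl ⟨hodd, m, ⟨hm, ⟨e⟩⟩, by omega⟩
    -- The arms are relabelled so that the short one comes last and the other two are in decreasing
    -- order.
    · obtain ⟨π, hπ, hle⟩ := exists_perm_arms m a
      have hm' : ∀ i, 1 ≤ (m ∘ π) i := fun i => hm _
      have hsum' := centreLeaves_add_longArms hm'
      rw [longArms_comp] at hsum'
      have hne : ∀ i, i ≠ 2 → π i ≠ a := fun i hi h => hi (π.injective (h.trans hπ.symm))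
      have hev0 : Even (m (π 0)) := hev _ (hne 0 (by decide))
      have hev1 : Even (m (π 1)) := hev _ (hne 1 (by decide))
      have h1 := hm (π 1)
      right
      refine ⟨?_, m ∘ π, ⟨⟨hm', ⟨e.trans (clawPermIso m π).symm⟩⟩, by omega⟩, hle, ?_, ?_,
        hev0, hev1⟩
      · rw [Nat.card_congr (e.trans (clawPermIso m π).symm).toEquiv, card_claw_vert]
        simp only [Function.comp_apply, hπ, ha]
        rw [add_assoc]
        exact (hev0.add hev1).add (by decide)
      · simp only [Function.comp_apply, hπ, ha]
        obtain ⟨p, hp⟩ := hev1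
        omega
      · simp only [Function.comp_apply, hπ, ha]
  · have h3 : paramIndex matchingNumber ⟨V, G⟩ ≤ 3 :=
      paramIndex_le_three (G := G) hG.2.1.preconnected matchingNumber_le_card_half (by omega)
    refine ⟨h3.trans (by decide), fun h => ?_⟩
    rw [h] at h3
    exact absurd h3 (by decide)

/-- The centre of degree 3 rules out paths and cycles; having at least five vertices rules out the
star. -/
theorem isProlific_of_iso_claw {V : Type u} {G : SimpleGraph V} {m : Fin 3 → ℕ}
    (hm : ∀ i, 1 ≤ m i) (hlong : 4 ≤ m 0 + m 1 + m 2) (e : G ≃g subdividedClaw m) :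
    IsProlific ⟨V, G⟩ := by
  have hdeg : ndegree G (e.symm none) = 3 := by
    rw [ndegree_iso e.symm, ndegree_claw_none hm]
  refine ⟨Finite.of_equiv _ e.toEquiv.symm, e.connected_iff.2 claw_connected, ?_, ?_, ?_⟩
  · rintro k ⟨f⟩
    have h1 := ndegree_pathGraph_le k (f (e.symm none))
    rw [ndegree_iso f, hdeg] at h1
    omega
  · rintro k hk ⟨f⟩
    have h1 := ndegree_cycleGraph_le hk (f (e.symm none))
    rw [ndegree_iso f, hdeg] at h1
    omega
  · rintro ⟨f⟩
    have h1 := Nat.card_congr (e.symm.toEquiv.trans f.toEquiv)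
    rw [card_claw_vert] at h1
    simp at h1
    omega

theorem exists_isProlific_paramIndex_eq_four :
    ∃ X : AnyGraph.{u}, IsProlific X ∧ paramIndex matchingNumber X = 4 := by
  -- The smallest type A claw, on five vertices; `Equiv.ulift` carries it to the universe `u`.
  let m : Fin 3 → ℕ := ![2, 1, 1]
  have hm : ∀ i, 1 ≤ m i := by decide
  let e := Iso.comap (Equiv.ulift.{u} (α := Option (Σ i : Fin 3, Fin (m i)))) (subdividedClaw m)
  have hG := isProlific_of_iso_claw hm (by decide) e
  refine ⟨_, hG, hG.paramIndex_eq_four (Or.inl ⟨?_, m, ⟨hm, ⟨e⟩⟩, ?_⟩)⟩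
  · rw [Nat.card_congr e.toEquiv, card_claw_vert]
    decide
  · have h1 := centreLeaves_add_longArms hm
    have h2 : longArms m = 1 := by decide
    omega

end prolific

theorem theoremG :
    (∀ (V : Type u) (G : SimpleGraph V), IsProlific ⟨V, G⟩ →
      paramIndex matchingNumber ⟨V, G⟩ ≤ 4 ∧
      (paramIndex matchingNumber ⟨V, G⟩ = 4 ↔
        (Odd (Nat.card V) ∧ ∃ m : Fin 3 → ℕ, IsTypeA ⟨V, G⟩ m) ∨
        (Even (Nat.card V) ∧ ∃ m : Fin 3 → ℕ, IsTypeB ⟨V, G⟩ m ∧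
          m 1 ≤ m 0 ∧ m 2 < m 1 ∧ m 2 = 1 ∧ Even (m 0) ∧ Even (m 1)))) ∧
    familyIndex matchingNumber {X : AnyGraph.{u} | IsProlific X} = 4 := by
  refine ⟨fun V G hG => hG.paramIndex_classification, le_antisymm ?_ ?_⟩
  · exact iSup₂_le fun X hX => (IsProlific.paramIndex_classification hX).1
  · obtain ⟨X, hX, h⟩ := exists_isProlific_paramIndex_eq_four.{u}
    rw [← h]
    exact le_iSup₂ (f := fun (X : AnyGraph.{u}) (_ : X ∈ {X | IsProlific X}) =>
      paramIndex matchingNumber X) X hX
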